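/- For $n\in\mathbb{Z}_{\ge 0}$ let $(x)_n=x(x+1)\cdots(x+n-1)$, with $(x)_0=1$, and for complex $k$ let $(x)_k=\Gamma(x+k)/\Gamma(x)$. (a) For every $k\in\mathbb{C}$ with $3k\notin\{-1,-2,-3,\dots\}$ the following series converges absolutely and $$\sum_{n=0}^{\infty}\left(\frac{-9}{16}\right)^n\frac{\left(\frac12-k\right)_n\left(\frac12+3k\right)_n\left(\frac13+k\right)_n\left(\frac23+k\right)_n}{\left(\frac12\right)_n(1)_n(1+k)_n(1+3k)_n}\cdot\frac{(5n+1)(2n+1)+k(16n+6k+7)}{2n+1}=\frac{4\sqrt3}{3\pi}\cdot 4^k\cdot\frac{(1)_k^2}{\left(\frac16\right)_k\left(\frac56\right)_k},$$ where the right-hand side is read as $0$, its limit, at the poles of $\left(\frac16\right)_k\left(\frac56\right)_k$. (b) This identity is WZ-demonstrable, in the following sense. Let $T(n,k)$ be the $n$-th term of the series and put $G(n,k)=T(n,k)\,4^{-k}\left(\frac16\right)_k\left(\frac56\right)_k/(1)_k^2$, and let $K$ be the set of all $k\in\mathbb{C}$ with $3k\notin\{-1,-2,\dots\}$ at which $\left(\frac16\right)_k$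 and $\left(\frac56\right)_k$ have no pole. Call a function $A(n,k)$ on $\mathbb{Z}_{\ge0}\times K$ hypergeometric if $A(n+1,k)/A(n,k)$ and $A(n,k+1)/A(n,k)$ are rational functions of $(n,k)$, i.e. if there are nonzero polynomials $p,q,r,s\in\mathbb{C}[n,k]$ with $p(n,k)A(n+1,k)=q(n,k)A(n,k)$ and $r(n,k)A(n,k+1)=s(n,k)A(n,k)$ for all $n\ge0$, $k\in K$. Then there is a function $F(n,k)$ such that $F$ and $G$ are both hypergeometric, such that $$F(n+1,k)-F(n,k)=G(n,k+1)-G(n,k)\qquad(n\ge 0,\ k\in K)$$ (that is, $(F,G)$ is a Wilf–Zeilberger pair), and such that $F(0,k)=0$ and $\lim_{n\to\infty}F(n,k)=0$ for all $k\in K$. (c) In the case $k=0$, $$\sum_{n=0}^{\infty}\left(\frac{-9}{16}\right)^n\frac{\left(\frac12\right)_n\left(\frac13\right)_n\left(\frac23\right)_n}{(1)_n^3}(5n+1)=\frac{4}{\sqrt3\,\pi}.$$ -/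

import Mathlib

open Filter Topology

noncomputable section

/-- The rising factorial `(x)_n = x (x + 1) ⋯ (x + n - 1)` with `n` a natural number. -/
def risingNat (x : ℂ) (n : ℕ) : ℂ := (ascPochhammer ℂ n).eval x

/-- The rising factorial `(x)_k = Γ(x + k) / Γ(x)` with complex index `k`. -/
def risingCpx (x k : ℂ) : ℂ := Complex.Gamma (x + k) / Complex.Gamma x

/-- `A(n, k)` is hypergeometric in its two variables (`k` in the set `K`): both quotients
`A(n+1, k) / A(n, k)` and `A(n, k+1) / A(n, k)` are rational functions of `(n, k)`.
Denominators are cleared, so that nothing is divided by zero. -/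
def IsHypergeometricOn (K : Set ℂ) (A : ℕ → ℂ → ℂ) : Prop :=
  (∃ p q : MvPolynomial (Fin 2) ℂ, p ≠ 0 ∧ q ≠ 0 ∧ ∀ n : ℕ, ∀ k ∈ K,
    MvPolynomial.eval ![(n : ℂ), k] p * A (n + 1) k
      = MvPolynomial.eval ![(n : ℂ), k] q * A n k) ∧
  (∃ p q : MvPolynomial (Fin 2) ℂ, p ≠ 0 ∧ q ≠ 0 ∧ ∀ n : ℕ, ∀ k ∈ K,
    MvPolynomial.eval ![(n : ℂ), k] p * A n (k + 1)
      = MvPolynomial.eval ![(n : ℂ), k] q * A n k)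

/-- `(F, G)` is a Wilf–Zeilberger pair, for `k` in `K` (a set stable under `k ↦ k + 1`). -/
def IsWZPairOn (K : Set ℂ) (F G : ℕ → ℂ → ℂ) : Prop :=
  IsHypergeometricOn K F ∧ IsHypergeometricOn K G ∧
  ∀ n : ℕ, ∀ k ∈ K, F (n + 1) k - F n k = G n (k + 1) - G n k

/-- The series `∑ G(n, k)` is WZ-demonstrable: `G` has a WZ companion `F` with `F(0, k) = 0` and
`F(n, k) → 0` as `n → ∞`. -/
def IsWZDemonstrableOn (K : Set ℂ) (G : ℕ → ℂ → ℂ) : Prop :=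
  ∃ F : ℕ → ℂ → ℂ, IsWZPairOn K F G ∧
    ∀ k ∈ K, F 0 k = 0 ∧ Tendsto (fun n : ℕ => F n k) atTop (𝓝 0)

/-- The `n`-th term of the series. -/
def seriesTerm (n : ℕ) (k : ℂ) : ℂ :=
  (-9 / 16) ^ n *
    (risingNat (1 / 2 - k) n * risingNat (1 / 2 + 3 * k) n *
        risingNat (1 / 3 + k) n * risingNat (2 / 3 + k) n /
      (risingNat (1 / 2) n * risingNat 1 n * risingNat (1 + k) n * risingNat (1 + 3 * k) n)) *
    (((5 * n + 1) * (2 * n + 1) + k * (16 * n + 6 * k + 7)) / (2 * n + 1))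

/-- The parameters `k` for which no term of the series has a zero denominator, that is,
`3 k ∉ {-1, -2, -3, …}` (this also excludes `k ∈ {-1, -2, -3, …}`). -/
def termDomain : Set ℂ := {k | ∀ m : ℕ, 3 * k ≠ -((m : ℂ) + 1)}

/-- The parameters `k` in `termDomain` at which moreover `(1/6)_k` and `(5/6)_k` have no pole. -/
def pairDomain : Set ℂ :=
  {k | k ∈ termDomain ∧ ∀ m : ℕ, 1 / 6 + k ≠ -(m : ℂ) ∧ 5 / 6 + k ≠ -(m : ℂ)}

/-- The summand normalised so that its sum over `n` does not depend on `k`. -/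
def normalizedTerm (n : ℕ) (k : ℂ) : ℂ :=
  seriesTerm n k *
    ((1 / 4 : ℂ) ^ k * (risingCpx (1 / 6) k * risingCpx (5 / 6) k / risingCpx 1 k ^ 2))

end

/-! ### Rising factorials -/

/-! Let T(n,k) be the summand, S(k) its sum over n and N(k) the normalising factor. A rational
certificate gives a companion with 4(1+k)²(F(n+1,k) − F(n,k)) = (1/6+k)(5/6+k)T(n,k+1) −
4(1+k)²T(n,k) (`companionTerm_sub`). Since N(k+1)/N(k) = (1/6+k)(5/6+k)/(4(1+k)²), multiplication by
N makes this the Wilf–Zeilberger equation. The companion vanishes at n = 0 and, the ratio of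
consecutive terms having modulus tending to 9/16, also as n → ∞. Telescoping therefore shows that
S·N has period one (`seriesSum_add_one`, `normalization_add_one`).

Periodicity alone does not make S·N constant. On Re k > 0 it is holomorphic, and on 1 ≤ Re k ≤ 2
with |Im k| ≥ 1 it is O(exp(π|Im k|)): S is compared with Euler's product for sinh
(`exists_bound_seriesSum`) and N is bounded through the beta integral
(`exists_bound_normalization`). A function of period one with this growth is constant, by a
Carlson-type argument: divide by sin(πz) and apply Liouville
(`apply_eq_apply_of_periodic_of_growth`).

The constant is read off at k = 1/2, where the factor (1/2 − k)_n annihilates every term but the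
first. The recurrence in k then carries the identity from the right half-plane to all of
`termDomain` (`seriesSum_eq_closedForm`), and k = 0 is the last claim. -/

lemma risingNat_zero (x : ℂ) : risingNat x 0 = 1 := by simp [risingNat]

lemma risingNat_succ (x : ℂ) (n : ℕ) : risingNat x (n + 1) = risingNat x n * (x + n) := by
  simp [risingNat, ascPochhammer_succ_eval]

lemma risingNat_succ_left (x : ℂ) (n : ℕ) : risingNat x (n + 1) = x * risingNat (x + 1) n := by
  simp [risingNat, ascPochhammer_succ_left, Polynomial.eval_comp]

/-- The shift relations in the argument are kept free of division, so that they hold at every `x`.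
The threefold version below serves the parameters c + 3k under k ↦ k + 1. -/
lemma mul_risingNat_add_one (x : ℂ) (n : ℕ) :
    x * risingNat (x + 1) n = risingNat x n * (x + n) := by
  rw [← risingNat_succ_left, risingNat_succ]

lemma mul_risingNat_add_three (x : ℂ) (n : ℕ) :
    x * (x + 1) * (x + 2) * risingNat (x + 3) n
      = risingNat x n * ((x + n) * (x + 1 + n) * (x + 2 + n)) := by
  have h0 := mul_risingNat_add_one x n
  have h1 := mul_risingNat_add_one (x + 1) n
  have h2 := mul_risingNat_add_one (x + 2) n
  rw [show x + 1 + 1 = x + 2 by ring] at h1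
  rw [show x + 2 + 1 = x + 3 by ring] at h2
  linear_combination x * (x + 1) * h2 + x * (x + 2 + n) * h1 + (x + 1 + n) * (x + 2 + n) * h0

lemma risingNat_ne_zero {x : ℂ} (hx : ∀ m : ℕ, x + m ≠ 0) (n : ℕ) : risingNat x n ≠ 0 := by
  induction n with
  | zero => simp [risingNat_zero]
  | succ n ih => rw [risingNat_succ]; exact mul_ne_zero ih (hx n)

/-! ### The domains -/

lemma one_add_three_mul_add_ne_zero {k : ℂ} (hk : k ∈ termDomain) (m : ℕ) :
    1 + 3 * k + m ≠ 0 := fun h => hk m (by linear_combination h)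

lemma one_add_add_ne_zero {k : ℂ} (hk : k ∈ termDomain) (m : ℕ) : 1 + k + m ≠ 0 := fun h =>
  hk (3 * m + 2) (by push_cast; linear_combination 3 * h)

lemma add_one_mem_termDomain {k : ℂ} (hk : k ∈ termDomain) : k + 1 ∈ termDomain := fun m h =>
  hk (m + 3) (by push_cast; linear_combination h)

lemma add_one_mem_pairDomain {k : ℂ} (hk : k ∈ pairDomain) : k + 1 ∈ pairDomain :=
  ⟨add_one_mem_termDomain hk.1, fun m =>
    ⟨fun h => (hk.2 (m + 1)).1 (by push_cast; linear_combination h),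
      fun h => (hk.2 (m + 1)).2 (by push_cast; linear_combination h)⟩⟩

lemma mem_termDomain_of_re_pos {k : ℂ} (hk : 0 < k.re) : k ∈ termDomain := fun m h => by
  have := congrArg Complex.re h
  simp at this
  have h0 : (0 : ℝ) ≤ m := m.cast_nonneg
  linarith

lemma one_half_add_ne_zero (m : ℕ) : (1 / 2 : ℂ) + m ≠ 0 := fun h => by
  have := congrArg Complex.re h
  norm_num at this
  have h0 : (0 : ℝ) ≤ m := m.cast_nonneg
  linarith

lemma one_add_cast_ne_zero (m : ℕ) : (1 : ℂ) + m ≠ 0 := by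
  rw [add_comm]; exact Nat.cast_add_one_ne_zero m

/-! ### The companion -/

/-- The hypergeometric part of `seriesTerm`. -/
noncomputable def hypergeometricPart (n : ℕ) (k : ℂ) : ℂ :=
  (-9 / 16) ^ n *
    (risingNat (1 / 2 - k) n * risingNat (1 / 2 + 3 * k) n *
        risingNat (1 / 3 + k) n * risingNat (2 / 3 + k) n /
      (risingNat (1 / 2) n * risingNat 1 n * risingNat (1 + k) n * risingNat (1 + 3 * k) n))

/-- The polynomial of the Wilf–Zeilberger certificate. -/
noncomputable def certificate (x k : ℂ) : ℂ :=
  (-1 + 75 * k + 324 * k ^ 2 + 324 * k ^ 3 + 79 * x + 432 * x * k + 540 * x * k ^ 2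
    + 108 * x ^ 2 + 252 * x ^ 2 * k + 36 * x ^ 3) / 9

/-- The Wilf–Zeilberger companion of `seriesTerm`, before normalisation. -/
noncomputable def companionTerm (n : ℕ) (k : ℂ) : ℂ :=
  (-9 / 16) ^ n *
    (n * risingNat (1 / 2 - k) (n - 1) * risingNat (1 / 2 + 3 * k) n *
        risingNat (1 / 3 + k) n * risingNat (2 / 3 + k) n /
      (risingNat (1 / 2) n * risingNat 1 n * risingNat (1 + k) n * risingNat (1 + 3 * k) n)) *
    (certificate n k / ((1 + 3 * k + n) * (2 + 3 * k + n)))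

lemma companionTerm_zero (k : ℂ) : companionTerm 0 k = 0 := by simp [companionTerm]

/-- The case n = 0 stands apart because of the truncated index n − 1 in `companionTerm`; the factor
n makes the companion vanish there. -/
lemma companionTerm_sub_zero {k : ℂ} (hk : k ∈ termDomain) :
    4 * (1 + k) ^ 2 * (companionTerm 1 k - companionTerm 0 k)
      = (1 / 6 + k) * (5 / 6 + k) * seriesTerm 0 (k + 1)
        - 4 * (1 + k) ^ 2 * seriesTerm 0 k := by
  have h1 := one_add_three_mul_add_ne_zero hk 0
  have h2 := one_add_three_mul_add_ne_zero hk 1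
  have h3 := one_add_three_mul_add_ne_zero hk 2
  have h4 := one_add_add_ne_zero hk 0
  simp only [companionTerm, seriesTerm, certificate, risingNat, ascPochhammer_one,
    ascPochhammer_zero, Polynomial.eval_one, Polynomial.eval_X]
  push_cast at *
  rw [show 1 + 3 * k + 1 = 2 + 3 * k by ring] at h2
  rw [show 1 + 3 * k + 2 = 3 * (1 + k) by ring] at h3
  rw [show 2 + 3 * k + 1 = 3 * (1 + k) by ring, show 1 + 3 * k + 1 = 2 + 3 * k by ring]
  simp only [add_zero] at h1 h4
  norm_num
  ring_nf at h1 h2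
  field_simp
  ring

/-- Every rising factorial is expressed through its value at the unshifted parameter, so a common
hypergeometric factor splits off and a polynomial identity in n and k remains. The index n − 1 of
the companion fits because (−1/2 − k)_n = (−1/2 − k)(1/2 − k)_{n−1}; no division by a factor that
may vanish is needed. -/
lemma companionTerm_sub_succ {k : ℂ} (hk : k ∈ termDomain) (m : ℕ) :
    4 * (1 + k) ^ 2 * (companionTerm (m + 2) k - companionTerm (m + 1) k)
      = (1 / 6 + k) * (5 / 6 + k) * seriesTerm (m + 1) (k + 1)
        - 4 * (1 + k) ^ 2 * seriesTerm (m + 1) k := by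
  set x : ℂ := (m : ℂ) with hx
  have a1 : 1 + 3 * k ≠ 0 := by simpa using one_add_three_mul_add_ne_zero hk 0
  have a2 : 2 + 3 * k ≠ 0 := by
    have := one_add_three_mul_add_ne_zero hk 1
    rw [Nat.cast_one] at this
    convert this using 1; ring
  have a3 : 1 + k ≠ 0 := by simpa using one_add_add_ne_zero hk 0
  have b1 : x + 2 + k ≠ 0 := by
    have := one_add_add_ne_zero hk (m + 1)
    push_cast at this
    convert this using 1; ring
  have b2 : x + 2 + 3 * k ≠ 0 := by
    have := one_add_three_mul_add_ne_zero hk (m + 1)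
    push_cast at this
    convert this using 1; ring
  have b3 : x + 3 + 3 * k ≠ 0 := by
    have := one_add_three_mul_add_ne_zero hk (m + 2)
    push_cast at this
    convert this using 1; ring
  have b4 : x + 4 + 3 * k ≠ 0 := by
    have := one_add_three_mul_add_ne_zero hk (m + 3)
    push_cast at this
    convert this using 1; ring
  have c1 : x + 2 ≠ 0 := by
    have := one_add_cast_ne_zero (m + 1)
    push_cast at this
    convert this using 1; ring
  have c2 : 2 * x + 3 ≠ 0 := by
    have := one_half_add_ne_zero (m + 1)
    push_cast at this
    intro h; apply this; linear_combination h / 2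
  have d1 := risingNat_ne_zero one_half_add_ne_zero (m + 1)
  have d2 := risingNat_ne_zero one_add_cast_ne_zero (m + 1)
  have d3 := risingNat_ne_zero (one_add_add_ne_zero hk) (m + 1)
  have d4 := risingNat_ne_zero (one_add_three_mul_add_ne_zero hk) (m + 1)
  have s1 := mul_risingNat_add_three (1 / 2 + 3 * k) (m + 1)
  have s2 := mul_risingNat_add_one (1 / 3 + k) (m + 1)
  have s3 := mul_risingNat_add_one (2 / 3 + k) (m + 1)
  have s4 := mul_risingNat_add_one (1 + k) (m + 1)
  have s5 := mul_risingNat_add_three (1 + 3 * k) (m + 1)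
  have s6 := risingNat_succ_left (1 / 2 - (k + 1)) m
  rw [show (1 / 2 - (k + 1) + 1 : ℂ) = 1 / 2 - k by ring] at s6
  simp only [companionTerm, seriesTerm, certificate, Nat.add_sub_cancel,
    show m + 2 - 1 = m + 1 from rfl, show m + 2 = (m + 1) + 1 from rfl]
  rw [s6]
  simp only [risingNat_succ _ (m + 1)]
  rw [risingNat_succ (1 / 2 - k) m]
  rw [show (1 / 2 + 3 * (k + 1) : ℂ) = 1 / 2 + 3 * k + 3 by ring,
    show (1 / 3 + (k + 1) : ℂ) = 1 / 3 + k + 1 by ring,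
    show (2 / 3 + (k + 1) : ℂ) = 2 / 3 + k + 1 by ring,
    show (1 + (k + 1) : ℂ) = 1 + k + 1 by ring,
    show (1 + 3 * (k + 1) : ℂ) = 1 + 3 * k + 3 by ring]
  push_cast at *
  rw [← hx] at *
  generalize risingNat (1 / 2) (m + 1) = A at *
  generalize risingNat 1 (m + 1) = B at *
  generalize risingNat (1 + k) (m + 1) = C at *
  generalize risingNat (1 + 3 * k) (m + 1) = D at *
  generalize risingNat (1 + k + 1) (m + 1) = C' at *
  generalize risingNat (1 + 3 * k + 3) (m + 1) = D' at *
  generalize risingNat (1 / 2 + 3 * k) (m + 1) = P at *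
  generalize risingNat (1 / 2 + 3 * k + 3) (m + 1) = P' at *
  generalize risingNat (1 / 3 + k) (m + 1) = Q at *
  generalize risingNat (1 / 3 + k + 1) (m + 1) = Q' at *
  generalize risingNat (2 / 3 + k) (m + 1) = R at *
  generalize risingNat (2 / 3 + k + 1) (m + 1) = R' at *
  generalize risingNat (1 / 2 - k) m = S at *
  obtain rfl : C' = C * (x + 2 + k) / (1 + k) := by
    field_simp; linear_combination s4
  obtain rfl : D' = D * ((x + 2 + 3 * k) * (x + 3 + 3 * k) * (x + 4 + 3 * k)) /
      ((1 + 3 * k) * (2 + 3 * k) * (3 * (1 + k))) := by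
    field_simp; linear_combination s5
  obtain rfl : Q' = Q * (3 * x + 4 + 3 * k) / (1 + 3 * k) := by
    field_simp; linear_combination 3 * s2
  obtain rfl : R' = R * (3 * x + 5 + 3 * k) / (2 + 3 * k) := by
    field_simp; linear_combination 3 * s3
  -- The shifted `P'` cannot be solved for by division, since k = −1/6, −1/2 and −5/6 are allowed.
  -- Instead (1/2+3k)(3/2+3k)(5/2+3k) = 27(1/6+k)(1/2+k)(5/6+k) absorbs exactly the prefactor and
  -- the factor 1/2 − (k+1) = −(1/2+k).
  have key : (1 / 6 + k) * (5 / 6 + k) * ((1 / 2 - (k + 1)) * P')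
      = - P * ((x + 3 / 2 + 3 * k) * (x + 5 / 2 + 3 * k) * (x + 7 / 2 + 3 * k)) / 27 := by
    linear_combination -s1 / 27
  have e : ∀ u v w y z t : ℂ, (1 / 6 + k) * (5 / 6 + k) *
      (u * ((1 / 2 - (k + 1)) * v * P' * w * y / z) * t)
      = u * (((1 / 6 + k) * (5 / 6 + k) * ((1 / 2 - (k + 1)) * P')) * v * w * y / z) * t := by
    intros; ring
  rw [e, key]
  rw [show 1 + 3 * k + (x + 1) = x + 2 + 3 * k by ring,
    show 2 + 3 * k + (x + 1) = x + 3 + 3 * k by ring,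
    show 1 + 3 * k + (x + 1 + 1) = x + 3 + 3 * k by ring,
    show 2 + 3 * k + (x + 1 + 1) = x + 4 + 3 * k by ring,
    show 2 * (x + 1) + 1 = 2 * x + 3 by ring,
    show 1 / 2 + (x + 1) = (2 * x + 3) / 2 by ring,
    show 1 + (x + 1) = x + 2 by ring,
    show 1 + k + (x + 1) = x + 2 + k by ring,
    pow_succ (-9 / 16 : ℂ) (m + 1)]
  generalize (-9 / 16 : ℂ) ^ (m + 1) = Z
  clear s1 s2 s3 s4 s5 s6 key e
  -- The linear forms in the denominators become atoms with known nonvanishing while fractions are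
  -- cleared, and are restored for the final polynomial identity.
  generalize e1 : 1 + 3 * k = u1 at *
  generalize e2 : 2 + 3 * k = u2 at *
  generalize e3 : 1 + k = u3 at *
  generalize e4 : x + 2 + k = v1 at *
  generalize e5 : x + 2 + 3 * k = v2 at *
  generalize e6 : x + 3 + 3 * k = v3 at *
  generalize e7 : x + 4 + 3 * k = v4 at *
  generalize e8 : x + 2 = w1 at *
  generalize e9 : 2 * x + 3 = w2 at *
  field_simp
  subst e1 e2 e3 e4 e5 e6 e7 e8 e9
  ring

/-- The Wilf–Zeilberger equation before normalisation. -/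
lemma companionTerm_sub {k : ℂ} (hk : k ∈ termDomain) (n : ℕ) :
    4 * (1 + k) ^ 2 * (companionTerm (n + 1) k - companionTerm n k)
      = (1 / 6 + k) * (5 / 6 + k) * seriesTerm n (k + 1)
        - 4 * (1 + k) ^ 2 * seriesTerm n k := by
  cases n with
  | zero => exact companionTerm_sub_zero hk
  | succ m => exact companionTerm_sub_succ hk m

/-! ### Hypergeometric functions of two variables -/

/-- The translate is nonzero because translation is invertible and a polynomial over an infinite
field is determined by its values. -/
lemma exists_shift_mvPolynomial (v : Fin 2 → ℂ) {p : MvPolynomial (Fin 2) ℂ} (hp : p ≠ 0) :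
    ∃ q : MvPolynomial (Fin 2) ℂ, q ≠ 0 ∧
      ∀ x, MvPolynomial.eval x q = MvPolynomial.eval (x + v) p := by
  have h : ∀ x, MvPolynomial.eval x
      (MvPolynomial.bind₁ (fun i => MvPolynomial.X i + MvPolynomial.C (v i)) p)
        = MvPolynomial.eval (x + v) p := by
    intro x
    rw [← MvPolynomial.coe_aeval_eq_eval, ← MvPolynomial.coe_aeval_eq_eval]
    simp only [RingHom.coe_coe]
    rw [MvPolynomial.aeval_bind₁]
    congr 2
    ext i
    simp
  refine ⟨_, fun h0 => hp (MvPolynomial.funext fun x => ?_), h⟩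
  have := h (x - v)
  rw [h0, sub_add_cancel] at this
  rw [← this, map_zero, map_zero]

lemma exists_affine_mvPolynomial {a b c : ℂ} (h : a ≠ 0 ∨ b ≠ 0 ∨ c ≠ 0) :
    ∃ p : MvPolynomial (Fin 2) ℂ, p ≠ 0 ∧
      ∀ x y : ℂ, MvPolynomial.eval ![x, y] p = a * x + b * y + c := by
  have he : ∀ x y : ℂ, MvPolynomial.eval ![x, y]
      (MvPolynomial.C a * MvPolynomial.X 0 + MvPolynomial.C b * MvPolynomial.X 1
        + MvPolynomial.C c) = a * x + b * y + c := by
    intro x y; simp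
  refine ⟨_, fun h0 => ?_, he⟩
  rw [h0] at he
  simp only [map_zero] at he
  have h00 := he 0 0
  have h10 := he 1 0
  have h01 := he 0 1
  simp only [mul_zero, mul_one, zero_add, add_zero] at h00 h10 h01
  simp [← h00] at h10 h01
  rcases h with h | h | h
  · exact h h10.symm
  · exact h h01.symm
  · exact h h00.symm

namespace IsHypergeometricOn

variable {K : Set ℂ} {A B : ℕ → ℂ → ℂ}

protected lemma mul (hA : IsHypergeometricOn K A) (hB : IsHypergeometricOn K B) :
    IsHypergeometricOn K (fun n k => A n k * B n k) := by
  obtain ⟨⟨p, q, hp, hq, h⟩, ⟨p', q', hp', hq', h'⟩⟩ := hA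
  obtain ⟨⟨r, s, hr, hs, g⟩, ⟨r', s', hr', hs', g'⟩⟩ := hB
  refine ⟨⟨p * r, q * s, mul_ne_zero hp hr, mul_ne_zero hq hs, fun n k hk => ?_⟩,
    ⟨p' * r', q' * s', mul_ne_zero hp' hr', mul_ne_zero hq' hs', fun n k hk => ?_⟩⟩
  · rw [map_mul, map_mul, mul_mul_mul_comm, h n k hk, g n k hk, mul_mul_mul_comm]
  · rw [map_mul, map_mul, mul_mul_mul_comm, h' n k hk, g' n k hk, mul_mul_mul_comm]

protected lemma inv (hA : IsHypergeometricOn K A) (hK : ∀ k ∈ K, k + 1 ∈ K)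
    (h0 : ∀ n, ∀ k ∈ K, A n k ≠ 0) : IsHypergeometricOn K (fun n k => (A n k)⁻¹) := by
  obtain ⟨⟨p, q, hp, hq, h⟩, ⟨p', q', hp', hq', h'⟩⟩ := hA
  refine ⟨⟨q, p, hq, hp, fun n k hk => ?_⟩, ⟨q', p', hq', hp', fun n k hk => ?_⟩⟩
  · have h1 := h0 n k hk
    have h2 := h0 (n + 1) k hk
    field_simp
    linear_combination -h n k hk
  · have h1 := h0 n k hk
    have h2 := h0 n (k + 1) (hK k hk)
    field_simp
    linear_combination -h' n k hk

protected lemma congr (hA : IsHypergeometricOn K A) (h : ∀ n k, B n k = A n k) :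
    IsHypergeometricOn K B := by
  rwa [show B = A from funext fun n => funext (h n)]

lemma of_eval {p : MvPolynomial (Fin 2) ℂ} (hp : p ≠ 0) :
    IsHypergeometricOn K (fun n k => MvPolynomial.eval ![(n : ℂ), k] p) := by
  obtain ⟨q, hq, h⟩ := exists_shift_mvPolynomial ![1, 0] hp
  obtain ⟨q', hq', h'⟩ := exists_shift_mvPolynomial ![0, 1] hp
  refine ⟨⟨p, q, hp, hq, fun n k _ => ?_⟩, ⟨p, q', hp, hq', fun n k _ => ?_⟩⟩
  · have : ![((n + 1 : ℕ) : ℂ), k] = ![(n : ℂ), k] + ![1, 0] := by simp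
    beta_reduce
    rw [h, mul_comm, this]
  · have : ![(n : ℂ), k + 1] = ![(n : ℂ), k] + ![0, 1] := by simp
    beta_reduce
    rw [h', mul_comm, this]

lemma affine {a b c : ℂ} (h : a ≠ 0 ∨ b ≠ 0 ∨ c ≠ 0) :
    IsHypergeometricOn K (fun n k => a * n + b * k + c) := by
  obtain ⟨p, hp, he⟩ := exists_affine_mvPolynomial h
  exact (of_eval hp).congr fun n k => (he n k).symm

lemma const_pow {c : ℂ} (hc : c ≠ 0) : IsHypergeometricOn K (fun n _ => c ^ n) :=
  ⟨⟨1, MvPolynomial.C c, one_ne_zero, by simpa using hc, fun n k _ => by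
    simp [pow_succ, mul_comm]⟩, ⟨1, 1, one_ne_zero, one_ne_zero, fun n k _ => by simp⟩⟩

lemma risingNat_const (c : ℂ) : IsHypergeometricOn K (fun n _ => risingNat c n) := by
  obtain ⟨p, hp, he⟩ := exists_affine_mvPolynomial (a := 1) (b := 0) (c := c) (by simp)
  refine ⟨⟨1, p, one_ne_zero, hp, fun n k _ => ?_⟩, ⟨1, 1, one_ne_zero, one_ne_zero, by simp⟩⟩
  beta_reduce
  rw [he, risingNat_succ, map_one]; ring

lemma risingNat_add (c : ℂ) : IsHypergeometricOn K (fun n k => risingNat (c + k) n) := by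
  obtain ⟨p, hp, he⟩ := exists_affine_mvPolynomial (a := 1) (b := 1) (c := c) (by simp)
  obtain ⟨q, hq, he'⟩ := exists_affine_mvPolynomial (a := 0) (b := 1) (c := c) (by simp)
  refine ⟨⟨1, p, one_ne_zero, hp, fun n k _ => ?_⟩, ⟨q, p, hq, hp, fun n k _ => ?_⟩⟩
  · beta_reduce
    rw [he, risingNat_succ, map_one]; ring
  · beta_reduce
    rw [he, he', ← add_assoc]
    linear_combination mul_risingNat_add_one (c + k) n

lemma risingNat_sub (c : ℂ) : IsHypergeometricOn K (fun n k => risingNat (c - k) n) := by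
  obtain ⟨p, hp, he⟩ := exists_affine_mvPolynomial (a := 1) (b := -1) (c := c) (by simp)
  obtain ⟨r, hr, he''⟩ := exists_affine_mvPolynomial (a := 1) (b := -1) (c := c - 1) (by simp)
  obtain ⟨q, hq, he'⟩ := exists_affine_mvPolynomial (a := 0) (b := -1) (c := c - 1) (by simp)
  refine ⟨⟨1, p, one_ne_zero, hp, fun n k _ => ?_⟩, ⟨r, q, hr, hq, fun n k _ => ?_⟩⟩
  · beta_reduce
    rw [he, risingNat_succ, map_one]; ring
  · have := mul_risingNat_add_one (c - (k + 1)) n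
    rw [show c - (k + 1) + 1 = c - k by ring] at this
    rw [he', he'']
    linear_combination -this

lemma risingNat_add_three_mul (c : ℂ) :
    IsHypergeometricOn K (fun n k => risingNat (c + 3 * k) n) := by
  have hp := fun c : ℂ => exists_affine_mvPolynomial (a := 1) (b := 3) (c := c) (by simp)
  have hq := fun c : ℂ => exists_affine_mvPolynomial (a := 0) (b := 3) (c := c) (by simp)
  choose p hp0 hp using hp
  choose q hq0 hq using hq
  refine ⟨⟨1, p c, one_ne_zero, hp0 c, fun n k _ => ?_⟩,
    ⟨q c * q (c + 1) * q (c + 2), p c * p (c + 1) * p (c + 2),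
      mul_ne_zero (mul_ne_zero (hq0 _) (hq0 _)) (hq0 _),
      mul_ne_zero (mul_ne_zero (hp0 _) (hp0 _)) (hp0 _), fun n k _ => ?_⟩⟩
  · beta_reduce
    rw [hp, risingNat_succ, map_one]; ring
  · have := mul_risingNat_add_three (c + 3 * k) n
    rw [show c + 3 * k + 3 = c + 3 * (k + 1) by ring] at this
    simp only [map_mul, hp, hq]
    linear_combination this

/-- This is the factor of the companion with the truncated index. At n = 0 both relations hold
because the factor n makes both sides vanish. -/
lemma mul_risingNat_sub_pred (c : ℂ) :
    IsHypergeometricOn K (fun n k => n * risingNat (c - k) (n - 1)) := by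
  have hp := fun c : ℂ => exists_affine_mvPolynomial (a := 1) (b := -1) (c := c) (by simp)
  choose p hp0 hp using hp
  obtain ⟨q, hq0, hq⟩ := exists_affine_mvPolynomial (a := 0) (b := -1) (c := c - 1) (by simp)
  obtain ⟨r, hr0, hr⟩ := exists_affine_mvPolynomial (a := 1) (b := 0) (c := 0) (by simp)
  obtain ⟨s, hs0, hs⟩ := exists_affine_mvPolynomial (a := 1) (b := 0) (c := 1) (by simp)
  refine ⟨⟨r, s * p (c - 1), hr0, mul_ne_zero hs0 (hp0 _), fun n k _ => ?_⟩,
    ⟨p (c - 2), q, hp0 _, hq0, fun n k _ => ?_⟩⟩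
  · rw [map_mul, hr, hs, hp]
    cases n with
    | zero => simp
    | succ m =>
      simp only [Nat.add_sub_cancel, risingNat_succ]; push_cast; ring
  · rw [hp, hq]
    cases n with
    | zero => simp
    | succ m =>
      have := mul_risingNat_add_one (c - (k + 1)) m
      rw [show c - (k + 1) + 1 = c - k by ring] at this
      simp only [Nat.add_sub_cancel]
      push_cast
      linear_combination -(m + 1 : ℂ) * this

end IsHypergeometricOn

/-! ### The normalisation -/

/-- The factor by which `normalizedTerm` differs from `seriesTerm`. -/
noncomputable def normalization (k : ℂ) : ℂ :=
  (1 / 4 : ℂ) ^ k * (risingCpx (1 / 6) k * risingCpx (5 / 6) k / risingCpx 1 k ^ 2)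

lemma Gamma_one_sixth_ne_zero : Complex.Gamma (1 / 6) ≠ 0 :=
  Complex.Gamma_ne_zero_of_re_pos (by norm_num)

lemma Gamma_five_sixths_ne_zero : Complex.Gamma (5 / 6) ≠ 0 :=
  Complex.Gamma_ne_zero_of_re_pos (by norm_num)

lemma risingCpx_add_one {x k : ℂ} (h : x + k ≠ 0) :
    risingCpx x (k + 1) = (x + k) * risingCpx x k := by
  rw [risingCpx, risingCpx, ← add_assoc, Complex.Gamma_add_one _ h, mul_div_assoc]

lemma risingCpx_one_ne_zero {k : ℂ} (hk : k ∈ termDomain) : risingCpx 1 k ≠ 0 := by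
  rw [risingCpx, Complex.Gamma_one, div_one]
  exact Complex.Gamma_ne_zero fun m h => one_add_add_ne_zero hk m (by rw [h]; ring)

lemma normalization_add_one {k : ℂ} (hk : k ∈ pairDomain) :
    4 * (1 + k) ^ 2 * normalization (k + 1) = (1 / 6 + k) * (5 / 6 + k) * normalization k := by
  have h1 : 1 / 6 + k ≠ 0 := by simpa using (hk.2 0).1
  have h2 : 5 / 6 + k ≠ 0 := by simpa using (hk.2 0).2
  have h3 : 1 + k ≠ 0 := by simpa using one_add_add_ne_zero hk.1 0
  have h4 := risingCpx_one_ne_zero hk.1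
  rw [normalization, normalization, risingCpx_add_one h1, risingCpx_add_one h2,
    risingCpx_add_one h3, Complex.cpow_add _ _ (by norm_num), Complex.cpow_one]
  generalize (1 / 4 : ℂ) ^ k = Z
  field_simp

lemma IsHypergeometricOn.normalization :
    IsHypergeometricOn pairDomain (fun _ k => normalization k) := by
  have hp := fun c : ℂ => exists_affine_mvPolynomial (a := 0) (b := 1) (c := c) (by simp)
  choose p hp0 hp using hp
  refine ⟨⟨1, 1, one_ne_zero, one_ne_zero, by simp⟩,
    ⟨MvPolynomial.C 4 * (p 1 * p 1), p (1 / 6) * p (5 / 6),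
      mul_ne_zero (by simp) (mul_ne_zero (hp0 _) (hp0 _)), mul_ne_zero (hp0 _) (hp0 _),
      fun n k hk => ?_⟩⟩
  simp only [map_mul, hp, MvPolynomial.eval_C]
  linear_combination normalization_add_one hk

/-! ### The Wilf–Zeilberger pair -/

/-- The Wilf–Zeilberger companion of `normalizedTerm`. -/
noncomputable def companion (n : ℕ) (k : ℂ) : ℂ := companionTerm n k * normalization k

lemma normalizedTerm_eq (n : ℕ) (k : ℂ) :
    normalizedTerm n k = seriesTerm n k * normalization k := rfl

lemma companion_sub {k : ℂ} (hk : k ∈ pairDomain) (n : ℕ) :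
    companion (n + 1) k - companion n k = normalizedTerm n (k + 1) - normalizedTerm n k := by
  have h3 : 1 + k ≠ 0 := by simpa using one_add_add_ne_zero hk.1 0
  have h := companionTerm_sub hk.1 n
  have h' := normalization_add_one hk
  rw [companion, companion, normalizedTerm_eq, normalizedTerm_eq]
  have h4 : (4 * (1 + k) ^ 2 : ℂ) ≠ 0 := by simpa using h3
  apply mul_left_cancel₀ h4
  linear_combination normalization k * h - seriesTerm n (k + 1) * h'

lemma isHypergeometricOn_denominator :
    IsHypergeometricOn pairDomain (fun n k => (risingNat (1 / 2) n * risingNat 1 n *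
      risingNat (1 + k) n * risingNat (1 + 3 * k) n)⁻¹) :=
  ((((IsHypergeometricOn.risingNat_const (1 / 2)).mul (.risingNat_const 1)).mul
    (.risingNat_add 1)).mul (.risingNat_add_three_mul 1)).inv
    (fun _ => add_one_mem_pairDomain) fun n _ hk =>
      mul_ne_zero (mul_ne_zero (mul_ne_zero (risingNat_ne_zero one_half_add_ne_zero n)
        (risingNat_ne_zero one_add_cast_ne_zero n))
        (risingNat_ne_zero (one_add_add_ne_zero hk.1) n))
        (risingNat_ne_zero (one_add_three_mul_add_ne_zero hk.1) n)

lemma isHypergeometricOn_normalizedTerm : IsHypergeometricOn pairDomain normalizedTerm := by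
  let p : MvPolynomial (Fin 2) ℂ := (5 * .X 0 + 1) * (2 * .X 0 + 1)
    + .X 1 * (16 * .X 0 + 6 * .X 1 + 7)
  have he : ∀ x y : ℂ, MvPolynomial.eval ![x, y] p
      = (5 * x + 1) * (2 * x + 1) + y * (16 * x + 6 * y + 7) := by
    intro x y; simp [p]
  have hp : p ≠ 0 := fun h => by
    have := he 0 0
    rw [h] at this
    norm_num at this
  have h2 : IsHypergeometricOn pairDomain (fun n k => (2 * (n : ℂ) + 0 * k + 1)⁻¹) :=
    (IsHypergeometricOn.affine (by simp)).inv (fun _ => add_one_mem_pairDomain) fun n k _ => by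
      rw [zero_mul, add_zero]; exact_mod_cast (2 * n).succ_ne_zero
  refine ((((((((IsHypergeometricOn.const_pow (c := -9 / 16) (by norm_num)).mul
    (.risingNat_sub (1 / 2))).mul (.risingNat_add_three_mul (1 / 2))).mul
    (.risingNat_add (1 / 3))).mul (.risingNat_add (2 / 3))).mul
    isHypergeometricOn_denominator).mul (.of_eval hp)).mul h2).mul .normalization |>.congr
      fun n k => ?_
  rw [normalizedTerm_eq, seriesTerm, he, zero_mul, add_zero]
  ring

lemma isHypergeometricOn_companion : IsHypergeometricOn pairDomain companion := by
  let p : MvPolynomial (Fin 2) ℂ := -1 + 75 * .X 1 + 324 * .X 1 ^ 2 + 324 * .X 1 ^ 3 + 79 * .X 0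
    + 432 * .X 0 * .X 1 + 540 * .X 0 * .X 1 ^ 2 + 108 * .X 0 ^ 2 + 252 * .X 0 ^ 2 * .X 1
    + 36 * .X 0 ^ 3
  have he : ∀ x y : ℂ, MvPolynomial.eval ![x, y] p = 9 * certificate x y := by
    intro x y; simp [p, certificate]; ring
  have hp : p ≠ 0 := fun h => by
    have := he 0 0
    rw [h] at this
    norm_num [certificate] at this
  have hd : ∀ c : ℕ, IsHypergeometricOn pairDomain
      (fun n k => ((1 : ℂ) * n + 3 * k + (c + 1))⁻¹) := fun c =>
    (IsHypergeometricOn.affine (by simp)).inv (fun _ => add_one_mem_pairDomain) fun n k hk h =>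
      one_add_three_mul_add_ne_zero hk.1 (n + c) (by push_cast; linear_combination h)
  -- The certificate is a polynomial with integer coefficients divided by 9; this constant restores
  -- the denominator.
  have h9 : IsHypergeometricOn pairDomain (fun n k => (0 : ℂ) * n + 0 * k + 1 / 9) :=
    .affine (by norm_num)
  refine ((((((((((IsHypergeometricOn.const_pow (c := -9 / 16) (by norm_num)).mul
    (.mul_risingNat_sub_pred (1 / 2))).mul (.risingNat_add_three_mul (1 / 2))).mul
    (.risingNat_add (1 / 3))).mul (.risingNat_add (2 / 3))).mul
    isHypergeometricOn_denominator).mul (.of_eval hp)).mul h9).mul (hd 0)).mul (hd 1)).mul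
      .normalization |>.congr fun n k => ?_
  rw [companion, companionTerm, he]
  push_cast
  rw [show (1 : ℂ) * n + 3 * k + (0 + 1) = 1 + 3 * k + n by ring,
    show (1 : ℂ) * n + 3 * k + (1 + 1) = 2 + 3 * k + n by ring, div_eq_mul_inv (certificate _ _),
    mul_inv (1 + 3 * k + n : ℂ)]
  ring

/-! ### Convergence of the series -/

lemma tendsto_add_div_add (c d : ℂ) :
    Tendsto (fun n : ℕ => (c + n) / (d + n)) atTop (𝓝 1) := by
  have h := (tendsto_natCast_div_add_atTop (𝕜 := ℂ) d).div
    (tendsto_natCast_div_add_atTop (𝕜 := ℂ) c) one_ne_zero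
  rw [div_one] at h
  refine h.congr' ?_
  filter_upwards [eventually_ne_atTop 0] with n hn
  simp only [Pi.div_apply]
  rw [div_div_div_cancel_left' _ _ (Nat.cast_ne_zero.mpr hn), add_comm c, add_comm d]

lemma tendsto_nat_add_two_div : Tendsto (fun n : ℕ => ((n : ℝ) + 2) / (n + 1)) atTop (𝓝 1) := by
  have h : Tendsto (fun n : ℕ => 1 + 1 / ((n : ℝ) + 1)) atTop (𝓝 (1 + 0)) :=
    tendsto_const_nhds.add tendsto_one_div_add_atTop_nhds_zero_nat
  rw [add_zero] at h
  refine h.congr fun n => ?_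
  field_simp
  ring

/-- Ratio test. The weight n + 1 absorbs factors of linear growth, and the recurrence is required
only from n = 1 on because the companion's term ratio is singular at n = 0. -/
lemma summable_add_one_mul_norm {a ρ : ℕ → ℂ} {r : ℝ} (hr : r < 1)
    (h : ∀ n, 1 ≤ n → a (n + 1) = ρ n * a n) (hρ : Tendsto (fun n => ‖ρ n‖) atTop (𝓝 r)) :
    Summable (fun n : ℕ => ((n : ℝ) + 1) * ‖a n‖) := by
  obtain ⟨s, hrs, hs⟩ := exists_between hr
  have h1 : Tendsto (fun n : ℕ => ((n : ℝ) + 2) / (n + 1) * ‖ρ n‖) atTop (𝓝 (1 * r)) :=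
    tendsto_nat_add_two_div.mul hρ
  rw [one_mul] at h1
  refine summable_of_ratio_norm_eventually_le hs ?_
  filter_upwards [h1.eventually (ge_mem_nhds hrs), eventually_ge_atTop 1] with n hn hn1
  have h0 : (0 : ℝ) < n + 1 := by positivity
  rw [h n hn1, Real.norm_of_nonneg (by positivity), Real.norm_of_nonneg (by positivity), norm_mul]
  push_cast
  calc ((n : ℝ) + 1 + 1) * (‖ρ n‖ * ‖a n‖)
      = (((n : ℝ) + 2) / (n + 1) * ‖ρ n‖) * ((n + 1) * ‖a n‖) := by field_simp; ring
    _ ≤ s * ((n + 1) * ‖a n‖) := by gcongr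

/-- No nonvanishing is assumed: with 0⁻¹ = 0 the inverse is multiplicative, so the relation survives
zero denominators. -/
lemma hypergeometricPart_succ (n : ℕ) (k : ℂ) :
    hypergeometricPart (n + 1) k = -9 / 16 * (((1 / 2 - k + n) / (1 / 2 + n)) *
      ((1 / 2 + 3 * k + n) / (1 + 3 * k + n)) * ((1 / 3 + k + n) / (1 + n)) *
      ((2 / 3 + k + n) / (1 + k + n))) * hypergeometricPart n k := by
  simp only [hypergeometricPart, risingNat_succ, pow_succ]
  simp only [div_eq_mul_inv, mul_inv]
  ring

lemma summable_add_one_mul_norm_hypergeometricPart (k : ℂ) :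
    Summable (fun n : ℕ => ((n : ℝ) + 1) * ‖hypergeometricPart n k‖) := by
  refine summable_add_one_mul_norm (r := 9 / 16) (by norm_num)
    (fun n _ => hypergeometricPart_succ n k) ?_
  have := (((tendsto_const_nhds (x := (-9 / 16 : ℂ))).mul
    (((tendsto_add_div_add (1 / 2 - k) (1 / 2)).mul
      (tendsto_add_div_add (1 / 2 + 3 * k) (1 + 3 * k))).mul
      (tendsto_add_div_add (1 / 3 + k) 1) |>.mul
      (tendsto_add_div_add (2 / 3 + k) (1 + k))))).norm
  convert this using 2
  norm_num

lemma norm_linear_factor_le (n : ℕ) (k : ℂ) :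
    ‖((5 * n + 1) * (2 * n + 1) + k * (16 * n + 6 * k + 7)) / (2 * n + 1)‖
      ≤ (n + 1) * (9 + 10 * ‖k‖ ^ 2) := by
  have h0 : (2 * n + 1 : ℂ) ≠ 0 := by exact_mod_cast (2 * n).succ_ne_zero
  have h1 : ‖(2 * n + 1 : ℂ)‖ = 2 * n + 1 := by
    rw [show (2 * n + 1 : ℂ) = ((2 * n + 1 : ℕ) : ℂ) by push_cast; ring, Complex.norm_natCast]
    push_cast; ring
  rw [norm_div, h1, div_le_iff₀ (by positivity)]
  have h2 : ‖(5 * n + 1 : ℂ)‖ ≤ 5 * n + 1 := by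
    refine (norm_add_le _ _).trans ?_
    simp
  have h3 : ‖(16 * n + 6 * k + 7 : ℂ)‖ ≤ 16 * n + 6 * ‖k‖ + 7 := by
    refine (norm_add_le _ _).trans ?_
    grw [norm_add_le]
    simp
  calc ‖((5 * n + 1) * (2 * n + 1) + k * (16 * n + 6 * k + 7) : ℂ)‖
      ≤ (5 * n + 1) * (2 * n + 1) + ‖k‖ * (16 * n + 6 * ‖k‖ + 7) := by
        grw [norm_add_le, norm_mul, norm_mul, h1, h2, h3]
    _ ≤ _ := by
        have hk := norm_nonneg k
        have hn : (0 : ℝ) ≤ n := n.cast_nonneg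
        nlinarith [mul_nonneg hn (sq_nonneg (‖k‖ - 1)), sq_nonneg (‖k‖ - 1), mul_nonneg hn hn,
          mul_nonneg hn (mul_nonneg hn (sq_nonneg ‖k‖)), mul_nonneg hn (sq_nonneg ‖k‖),
          mul_nonneg (mul_nonneg hn hn) (sq_nonneg (‖k‖ - 1))]

lemma seriesTerm_eq (n : ℕ) (k : ℂ) : seriesTerm n k = hypergeometricPart n k *
    (((5 * n + 1) * (2 * n + 1) + k * (16 * n + 6 * k + 7)) / (2 * n + 1)) := rfl

lemma norm_seriesTerm_le (n : ℕ) (k : ℂ) :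
    ‖seriesTerm n k‖ ≤ (9 + 10 * ‖k‖ ^ 2) * ((n + 1) * ‖hypergeometricPart n k‖) := by
  rw [seriesTerm_eq, norm_mul]
  grw [norm_linear_factor_le]
  exact le_of_eq (by ring)

lemma summable_seriesTerm (k : ℂ) : Summable (fun n => seriesTerm n k) :=
  .of_norm_bounded ((summable_add_one_mul_norm_hypergeometricPart k).mul_left _)
    (fun n => norm_seriesTerm_le n k)

lemma tendsto_companionTerm (k : ℂ) : Tendsto (fun n => companionTerm n k) atTop (𝓝 0) := by
  let g : ℕ → ℂ := fun n => (-9 / 16) ^ n *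
    (n * risingNat (1 / 2 - k) (n - 1) * risingNat (1 / 2 + 3 * k) n *
        risingNat (1 / 3 + k) n * risingNat (2 / 3 + k) n /
      (risingNat (1 / 2) n * risingNat 1 n * risingNat (1 + k) n * risingNat (1 + 3 * k) n))
  have hs : Summable (fun n : ℕ => ((n : ℝ) + 1) * ‖g n‖) := by
    refine summable_add_one_mul_norm (r := 9 / 16) (ρ := fun n => -9 / 16 *
      (((1 + n) / (0 + n)) * ((-1 / 2 - k + n) / (1 / 2 + n)) *
      ((1 / 2 + 3 * k + n) / (1 + 3 * k + n)) * ((1 / 3 + k + n) / (1 + n)) *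
      ((2 / 3 + k + n) / (1 + k + n)))) (by norm_num) (fun n hn => ?_) ?_
    · obtain ⟨m, rfl⟩ := Nat.exists_eq_add_of_le' hn
      have hm : ((m + 1 : ℕ) : ℂ) ≠ 0 := Nat.cast_ne_zero.mpr m.succ_ne_zero
      simp only [g, Nat.add_sub_cancel]
      rw [risingNat_succ (1 / 2 - k) m]
      simp only [risingNat_succ _ (m + 1), pow_succ _ (m + 1)]
      rw [zero_add, show -1 / 2 - k + ((m + 1 : ℕ) : ℂ) = 1 / 2 - k + m by push_cast; ring,
        show ((m + 1 + 1 : ℕ) : ℂ) = 1 + ((m + 1 : ℕ) : ℂ) by push_cast; ring]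
      generalize ((m + 1 : ℕ) : ℂ) = y at *
      generalize 1 / 2 - k + (m : ℂ) = c₁
      generalize 1 / 2 + 3 * k + y = c₂
      generalize 1 / 3 + k + y = c₃
      generalize 2 / 3 + k + y = c₄
      generalize 1 / 2 + y = d₁
      generalize 1 + 3 * k + y = d₂
      generalize 1 + k + y = d₃
      generalize 1 + y = d₄
      generalize risingNat _ _ = r₁
      generalize risingNat _ _ = r₂
      generalize risingNat _ _ = r₃
      generalize risingNat _ _ = r₄
      generalize risingNat _ _ = r₅
      generalize risingNat _ _ = r₆
      generalize risingNat _ _ = r₇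
      generalize risingNat _ _ = r₈
      generalize (-9 / 16 : ℂ) = q
      simp only [div_eq_mul_inv, mul_inv]
      linear_combination -(q ^ (m + 1) * q * d₄ * c₁ * c₂ * c₃ * c₄ * d₁⁻¹ * d₂⁻¹ * d₃⁻¹ * d₄⁻¹
        * r₁ * r₂ * r₃ * r₄ * r₅⁻¹ * r₆⁻¹ * r₇⁻¹ * r₈⁻¹) * mul_inv_cancel₀ hm
    · have := ((tendsto_const_nhds (x := (-9 / 16 : ℂ))).mul
        (((((tendsto_add_div_add 1 0).mul (tendsto_add_div_add (-1 / 2 - k) (1 / 2))).mul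
        (tendsto_add_div_add (1 / 2 + 3 * k) (1 + 3 * k))).mul
        (tendsto_add_div_add (1 / 3 + k) 1)).mul
        (tendsto_add_div_add (2 / 3 + k) (1 + k)))).norm
      convert this using 2
      norm_num
  -- The certificate is cubic in n and is divided by a quadratic. The quotient grows linearly, with
  -- slope the leading coefficient 36/9, and the weight n + 1 in `hs` compensates for it.
  have hb : Tendsto (fun n : ℕ => certificate n k / ((1 + 3 * k + n) * (2 + 3 * k + n)) / (n + 1))
      atTop (𝓝 (36 / 9)) := by
    have hi : Tendsto (fun n : ℕ => ((n : ℂ))⁻¹) atTop (𝓝 0) := tendsto_inv_atTop_nhds_zero_nat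
    have h1 : Tendsto (fun n : ℕ => ((-1 + 75 * k + 324 * k ^ 2 + 324 * k ^ 3) * (n : ℂ)⁻¹ ^ 3
        + (79 + 432 * k + 540 * k ^ 2) * (n : ℂ)⁻¹ ^ 2 + (108 + 252 * k) * (n : ℂ)⁻¹ + 36) / 9
        * (((0 + n) / (1 + 3 * k + n)) * ((0 + n) / (2 + 3 * k + n)) * ((0 + n) / (1 + n))))
        atTop (𝓝 (((-1 + 75 * k + 324 * k ^ 2 + 324 * k ^ 3) * 0 ^ 3
        + (79 + 432 * k + 540 * k ^ 2) * 0 ^ 2 + (108 + 252 * k) * 0 + 36) / 9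
        * (1 * 1 * 1))) :=
      Tendsto.mul ((((((hi.pow 3).const_mul _).add ((hi.pow 2).const_mul _)).add
        (hi.const_mul _)).add_const _).div_const _)
        (((tendsto_add_div_add 0 _).mul (tendsto_add_div_add 0 _)).mul (tendsto_add_div_add 0 _))
    rw [show (((-1 + 75 * k + 324 * k ^ 2 + 324 * k ^ 3) * 0 ^ 3
        + (79 + 432 * k + 540 * k ^ 2) * 0 ^ 2 + (108 + 252 * k) * 0 + 36) / 9
        * (1 * 1 * 1)) = 36 / 9 by ring] at h1
    refine h1.congr' ?_
    filter_upwards [eventually_ne_atTop 0] with n hn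
    have hn' : (n : ℂ) ≠ 0 := Nat.cast_ne_zero.mpr hn
    rw [certificate, zero_add, add_comm 1 (n : ℂ)]
    simp only [div_eq_mul_inv, mul_inv]
    generalize (1 + 3 * k + n)⁻¹ = u
    generalize (2 + 3 * k + n)⁻¹ = v
    generalize ((n : ℂ) + 1)⁻¹ = w
    field_simp
    ring
  have hg : Tendsto (fun n : ℕ => ((n : ℂ) + 1) * g n) atTop (𝓝 0) := by
    rw [tendsto_zero_iff_norm_tendsto_zero]
    refine hs.tendsto_atTop_zero.congr fun n => ?_
    rw [norm_mul ((n : ℂ) + 1)]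
    congr 1
    rw [← Nat.cast_add_one, ← Nat.cast_add_one, Complex.norm_natCast]
  have := hg.mul hb
  rw [zero_mul] at this
  refine this.congr fun n => ?_
  have hn : (n : ℂ) + 1 ≠ 0 := Nat.cast_add_one_ne_zero n
  change _ = g n * _
  field_simp

/-- The sum of the series. -/
noncomputable def seriesSum (k : ℂ) : ℂ := ∑' n, seriesTerm n k

lemma seriesSum_add_one {k : ℂ} (hk : k ∈ termDomain) :
    (1 / 6 + k) * (5 / 6 + k) * seriesSum (k + 1) = 4 * (1 + k) ^ 2 * seriesSum k := by
  have h1 := (((summable_seriesTerm (k + 1)).hasSum.mul_left ((1 / 6 + k) * (5 / 6 + k))).sub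
    ((summable_seriesTerm k).hasSum.mul_left (4 * (1 + k) ^ 2))).tendsto_sum_nat
  -- The partial sums telescope to a multiple of the companion, whose limit is zero.
  have h2 : ∀ N, ∑ n ∈ Finset.range N, ((1 / 6 + k) * (5 / 6 + k) * seriesTerm n (k + 1)
      - 4 * (1 + k) ^ 2 * seriesTerm n k) = 4 * (1 + k) ^ 2 * companionTerm N k := by
    intro N
    simp_rw [← companionTerm_sub hk]
    rw [← Finset.mul_sum, Finset.sum_range_sub (fun n => companionTerm n k), companionTerm_zero,
      sub_zero]
  simp_rw [h2] at h1
  have h3 := tendsto_nhds_unique h1 ((tendsto_companionTerm k).const_mul _)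
  rw [mul_zero] at h3
  exact sub_eq_zero.mp h3

/-! ### Holomorphy and growth on the right half-plane -/

/-- The two numbers have opposite imaginary parts, and |1/2 − Re k + n| ≤ 1 + Re k + n. -/
lemma norm_sub_add_le_norm_add {k : ℂ} (hk : 0 < k.re) (n : ℕ) :
    ‖1 / 2 - k + n‖ ≤ ‖1 + k + n‖ := by
  refine abs_le_of_sq_le_sq' ?_ (norm_nonneg _) |>.2
  rw [← Complex.normSq_eq_norm_sq, ← Complex.normSq_eq_norm_sq, Complex.normSq_apply,
    Complex.normSq_apply]
  have hn : (0 : ℝ) ≤ n := n.cast_nonneg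
  simp
  nlinarith

lemma norm_one_half_add_le_norm_one_add {k : ℂ} (hk : 0 < k.re) (n : ℕ) :
    ‖1 / 2 + 3 * k + n‖ ≤ ‖1 + 3 * k + n‖ := by
  refine abs_le_of_sq_le_sq' ?_ (norm_nonneg _) |>.2
  rw [← Complex.normSq_eq_norm_sq, ← Complex.normSq_eq_norm_sq, Complex.normSq_apply,
    Complex.normSq_apply]
  have hn : (0 : ℝ) ≤ n := n.cast_nonneg
  simp
  nlinarith

/-- For Re k > 0 the factors 1/2 − k and 1/2 + 3k are paired with 1 + k and 1 + 3k, giving quotients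
of modulus at most one; only (1/3+k)_n (2/3+k)_n/((1/2)_n n!) remains. The bound `b` is left free:
one choice serves locally uniform convergence, another the growth in vertical strips. -/
lemma norm_hypergeometricPart_le {k : ℂ} (hk : 0 < k.re) {b : ℕ → ℝ}
    (hb : ∀ j : ℕ, ‖1 / 3 + k + j‖ * ‖2 / 3 + k + j‖ ≤ b j) (n : ℕ) :
    ‖hypergeometricPart n k‖
      ≤ (9 / 16) ^ n * ∏ j ∈ Finset.range n, b j / ((j : ℝ) + 1 / 2) ^ 2 := by
  induction n with
  | zero => simp [hypergeometricPart, risingNat_zero]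
  | succ n ih =>
    have h1 : ‖(1 / 2 + n : ℂ)‖ = n + 1 / 2 := by
      rw [show (1 / 2 + n : ℂ) = ((n + 1 / 2 : ℝ) : ℂ) by push_cast; ring, Complex.norm_real,
        Real.norm_of_nonneg (by positivity)]
    have h2 : ‖(1 + n : ℂ)‖ = n + 1 := by
      rw [show (1 + n : ℂ) = ((n + 1 : ℕ) : ℂ) by push_cast; ring, Complex.norm_natCast]
      push_cast; ring
    have h3 : ‖1 / 2 - k + n‖ / ‖1 + k + n‖ ≤ 1 :=
      div_le_one_of_le₀ (norm_sub_add_le_norm_add hk n) (norm_nonneg _)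
    have h4 : ‖1 / 2 + 3 * k + n‖ / ‖1 + 3 * k + n‖ ≤ 1 :=
      div_le_one_of_le₀ (norm_one_half_add_le_norm_one_add hk n) (norm_nonneg _)
    rw [hypergeometricPart_succ, Finset.prod_range_succ, pow_succ]
    simp only [norm_mul, norm_div, h1, h2]
    have h5 : ‖(-9 : ℂ)‖ / ‖(16 : ℂ)‖ = 9 / 16 := by norm_num
    have h6 : 0 ≤ b n := le_trans (by positivity) (hb n)
    calc _ = (‖(-9 : ℂ)‖ / ‖(16 : ℂ)‖) * ((‖1 / 2 - k + n‖ / ‖1 + k + n‖) *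
          (‖1 / 2 + 3 * k + n‖ / ‖1 + 3 * k + n‖) *
          (‖1 / 3 + k + n‖ * ‖2 / 3 + k + n‖ / ((n + 1 / 2) * (n + 1)))) *
            ‖hypergeometricPart n k‖ := by
          simp only [div_eq_mul_inv, mul_inv]; ring
      _ ≤ 9 / 16 * (1 * 1 * (b n / ((n + 1 / 2) * (n + 1 / 2)))) *
          ((9 / 16) ^ n * ∏ j ∈ Finset.range n, b j / ((j : ℝ) + 1 / 2) ^ 2) := by
          rw [h5]
          gcongr
          · exact hb n
          · norm_num
      _ = _ := by ring

/-- A majorant of the hypergeometric part. -/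
noncomputable def majorant (R : ℝ) (n : ℕ) : ℝ :=
  (9 / 16) ^ n * ∏ j ∈ Finset.range n, ((j : ℝ) + 1 + R) ^ 2 / ((j : ℝ) + 1 / 2) ^ 2

lemma majorant_nonneg (R : ℝ) (n : ℕ) : 0 ≤ majorant R n :=
  mul_nonneg (by positivity) (Finset.prod_nonneg fun _ _ => by positivity)

lemma summable_majorant (R : ℝ) : Summable (fun n : ℕ => ((n : ℝ) + 1) * majorant R n) := by
  have := summable_add_one_mul_norm (a := fun n => (majorant R n : ℂ)) (r := 9 / 16)
    (ρ := fun n => 9 / 16 * ((1 + R + n) / (1 / 2 + n)) ^ 2) (by norm_num) (fun n _ => ?_) ?_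
  · simpa [abs_of_nonneg (majorant_nonneg R _)] using this
  · rw [majorant, majorant, Finset.prod_range_succ, pow_succ]
    push_cast
    rw [div_pow (1 + R + n : ℂ), add_comm (1 / 2 : ℂ) n, add_comm (1 + R : ℂ) n, ← add_assoc]
    generalize ∏ j ∈ Finset.range n, ((j : ℂ) + 1 + R) ^ 2 / ((j : ℂ) + 1 / 2) ^ 2 = P
    generalize ((n : ℂ) + 1 + R) ^ 2 / ((n : ℂ) + 1 / 2) ^ 2 = Q
    ring
  · have := ((tendsto_const_nhds (x := (9 / 16 : ℂ))).mul
      ((tendsto_add_div_add (1 + R) (1 / 2)).pow 2)).norm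
    convert this using 2
    norm_num

lemma differentiableOn_risingNat {s : Set ℂ} {f : ℂ → ℂ} (hf : DifferentiableOn ℂ f s) (n : ℕ) :
    DifferentiableOn ℂ (fun k => risingNat (f k) n) s :=
  (ascPochhammer ℂ n).differentiable.comp_differentiableOn hf

lemma differentiableOn_seriesTerm (n : ℕ) :
    DifferentiableOn ℂ (seriesTerm n) {k | 0 < k.re} := by
  refine DifferentiableOn.mul (DifferentiableOn.const_mul (DifferentiableOn.div
    (((?_ : DifferentiableOn ℂ _ _).mul ?_ |>.mul ?_).mul ?_)
    ((DifferentiableOn.const_mul ?_ _).mul ?_) fun k hk => ?_) _)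
    (by fun_prop)
  iterate 6 exact differentiableOn_risingNat (by fun_prop) n
  have hk := mem_termDomain_of_re_pos hk
  exact mul_ne_zero (mul_ne_zero (mul_ne_zero (risingNat_ne_zero one_half_add_ne_zero n)
        (risingNat_ne_zero one_add_cast_ne_zero n))
        (risingNat_ne_zero (one_add_add_ne_zero hk) n))
        (risingNat_ne_zero (one_add_three_mul_add_ne_zero hk) n)

lemma norm_hypergeometricPart_le_majorant {k : ℂ} (hk : 0 < k.re) {R : ℝ} (hR : ‖k‖ ≤ R) (n : ℕ) :
    ‖hypergeometricPart n k‖ ≤ majorant R n := by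
  refine norm_hypergeometricPart_le hk (fun j => ?_) n
  have h : ∀ c : ℂ, ‖c‖ ≤ 1 → ‖c + k + j‖ ≤ j + 1 + R := fun c hc => by
    refine (norm_add₃_le).trans ?_
    rw [Complex.norm_natCast]
    linarith
  rw [sq]
  gcongr
  · linarith [(norm_nonneg _).trans (h 0 (by simp))]
  · exact h _ (by norm_num)
  · exact h _ (by norm_num)

lemma differentiableOn_seriesSum : DifferentiableOn ℂ seriesSum {k | 0 < k.re} := by
  intro k hk
  have ho : IsOpen ({k : ℂ | 0 < k.re} ∩ Metric.ball 0 (‖k‖ + 1)) :=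
    (isOpen_lt continuous_const Complex.continuous_re).inter Metric.isOpen_ball
  have hm : k ∈ {k : ℂ | 0 < k.re} ∩ Metric.ball 0 (‖k‖ + 1) := ⟨hk, by simp⟩
  have := Complex.differentiableOn_tsum_of_summable_norm
    (u := fun n : ℕ => (9 + 10 * (‖k‖ + 1) ^ 2) * (((n : ℝ) + 1) * majorant (‖k‖ + 1) n))
    ((summable_majorant (‖k‖ + 1)).mul_left _)
    (fun n => (differentiableOn_seriesTerm n).mono Set.inter_subset_left) ho
    (fun n w hw => ?_)
  · exact (this.differentiableAt (ho.mem_nhds hm)).differentiableWithinAt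
  · have hw2 : ‖w‖ ≤ ‖k‖ + 1 := by simpa using (Metric.mem_ball.mp hw.2).le
    have := norm_hypergeometricPart_le_majorant hw.1 hw2 n
    grw [norm_seriesTerm_le, hw2, this]

/-! ### Growth estimates in the vertical direction -/

lemma norm_sin_le (z : ℂ) : ‖Complex.sin z‖ ≤ Real.exp |z.im| := by
  have h1 : ‖Complex.exp (-z * Complex.I)‖ ≤ Real.exp |z.im| := by
    rw [Complex.norm_exp, Real.exp_le_exp]
    simpa using le_abs_self z.im
  have h2 : ‖Complex.exp (z * Complex.I)‖ ≤ Real.exp |z.im| := by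
    rw [Complex.norm_exp, Real.exp_le_exp]
    simpa using neg_le_abs z.im
  rw [Complex.sin, norm_div, norm_mul, Complex.norm_I, mul_one, Complex.norm_ofNat,
    div_le_iff₀ two_pos]
  grw [norm_sub_le, h1, h2]
  linarith

/-- One of the two exponentials in sin z has modulus exp |Im z| ≥ 2, the other at most 1. -/
lemma exp_abs_im_le_norm_sin {z : ℂ} (hz : 1 ≤ |z.im|) :
    Real.exp |z.im| ≤ 4 * ‖Complex.sin z‖ := by
  have h0 : 2 ≤ Real.exp |z.im| := by
    have := Real.add_one_le_exp |z.im|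
    linarith
  have h1 : ‖Complex.exp (-z * Complex.I)‖ = Real.exp z.im := by
    rw [Complex.norm_exp]; simp
  have h2 : ‖Complex.exp (z * Complex.I)‖ = Real.exp (-z.im) := by
    rw [Complex.norm_exp]; simp
  have h3 : |Real.exp z.im - Real.exp (-z.im)|
      ≤ ‖Complex.exp (-z * Complex.I) - Complex.exp (z * Complex.I)‖ := by
    rw [← h1, ← h2]; exact abs_norm_sub_norm_le _ _
  rw [Complex.sin, norm_div, norm_mul, Complex.norm_I, mul_one, Complex.norm_ofNat]
  rcases abs_cases z.im with ⟨h, h'⟩ | ⟨h, h'⟩ <;> rw [h] at h0 hz ⊢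
  · have h4 : Real.exp (-z.im) ≤ 1 := Real.exp_le_one_iff.mpr (by linarith)
    linarith [le_abs_self (Real.exp z.im - Real.exp (-z.im))]
  · have h4 : Real.exp z.im ≤ 1 := Real.exp_le_one_iff.mpr (by linarith)
    linarith [neg_le_abs (Real.exp z.im - Real.exp (-z.im))]

/-- Euler's sine product at `t * I`: the factors are at least one, so the partial products increase
to |sin(πit)|. -/
lemma euler_sinh_partial_prod_le (t : ℝ) (n : ℕ) :
    Real.pi * |t| * ∏ j ∈ Finset.range n, (1 + t ^ 2 / ((j : ℝ) + 1) ^ 2)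
      ≤ Real.exp (Real.pi * |t|) := by
  have h := (Complex.tendsto_euler_sin_prod (t * Complex.I)).norm
  have h1 : ∀ n : ℕ, ‖(Real.pi : ℂ) * (t * Complex.I) *
      ∏ j ∈ Finset.range n, (1 - (t * Complex.I) ^ 2 / ((j : ℂ) + 1) ^ 2)‖
      = Real.pi * |t| * ∏ j ∈ Finset.range n, (1 + t ^ 2 / ((j : ℝ) + 1) ^ 2) := by
    intro n
    rw [norm_mul, norm_mul, norm_mul, norm_prod, Complex.norm_I, mul_one, Complex.norm_real,
      Complex.norm_real, Real.norm_of_nonneg Real.pi_pos.le, Real.norm_eq_abs]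
    congr 1
    refine Finset.prod_congr rfl fun j _ => ?_
    rw [mul_pow, Complex.I_sq, show (1 - (t : ℂ) ^ 2 * -1 / ((j : ℂ) + 1) ^ 2)
      = ((1 + t ^ 2 / ((j : ℝ) + 1) ^ 2 : ℝ) : ℂ) by push_cast; ring, Complex.norm_real,
      Real.norm_of_nonneg (by positivity)]
  simp_rw [h1] at h
  refine (Monotone.ge_of_tendsto (monotone_nat_of_le_succ fun n => ?_) h n).trans ?_
  · rw [Finset.prod_range_succ, ← mul_assoc]
    refine le_mul_of_one_le_right (mul_nonneg (by positivity)
      (Finset.prod_nonneg fun _ _ => by positivity)) ?_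
    have : 0 ≤ t ^ 2 / ((n : ℝ) + 1) ^ 2 := by positivity
    linarith
  · refine (norm_sin_le _).trans (le_of_eq ?_)
    simp [abs_mul, abs_of_pos Real.pi_pos]

/-- Dropping the first two Euler factors gains a factor 1 + t², which pays for the quadratic
dependence on k in `norm_seriesTerm_le`. -/
lemma euler_sinh_shifted_partial_prod_le (t : ℝ) (n : ℕ) :
    |t| * (1 + t ^ 2) * ∏ j ∈ Finset.range n, (1 + t ^ 2 / ((j : ℝ) + 3) ^ 2)
      ≤ Real.exp (Real.pi * |t|) := by
  have h := euler_sinh_partial_prod_le t (n + 2)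
  rw [Finset.prod_range_succ', Finset.prod_range_succ'] at h
  have hP : 0 ≤ ∏ j ∈ Finset.range n, (1 + t ^ 2 / ((j : ℝ) + 3) ^ 2) :=
    Finset.prod_nonneg fun _ _ => by positivity
  have he : ∏ j ∈ Finset.range n, (1 + t ^ 2 / (((j + 1 + 1 : ℕ) : ℝ) + 1) ^ 2)
      = ∏ j ∈ Finset.range n, (1 + t ^ 2 / ((j : ℝ) + 3) ^ 2) :=
    Finset.prod_congr rfl fun j _ => by push_cast; ring
  rw [he] at h
  refine le_trans ?_ h
  set P := ∏ j ∈ Finset.range n, (1 + t ^ 2 / ((j : ℝ) + 3) ^ 2)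
  have h1 : (1 : ℝ) ≤ Real.pi := by linarith [Real.pi_gt_three]
  calc |t| * (1 + t ^ 2) * P = 1 * |t| * (P * 1 * (1 + t ^ 2)) := by ring
    _ ≤ Real.pi * |t| * (P * (1 + t ^ 2 / 4) * (1 + t ^ 2)) := by
      have : 1 ≤ 1 + t ^ 2 / 4 := by linarith [sq_nonneg t]
      gcongr
    _ = _ := by norm_num

lemma norm_hypergeometricPart_le_of_mem_strip {k : ℂ} (h1 : 1 ≤ k.re) (h2 : k.re ≤ 2) (n : ℕ) :
    ‖hypergeometricPart n k‖
      ≤ majorant 2 n * ∏ j ∈ Finset.range n, (1 + k.im ^ 2 / ((j : ℝ) + 3) ^ 2) := by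
  -- As Re k ≤ 2 and c ≤ 1, the real part is at most j + 3; this fixes the shift in the Euler
  -- product.
  have hb : ∀ c : ℝ, 0 ≤ c → c ≤ 1 → ∀ j : ℕ,
      ‖(c : ℂ) + k + j‖ ^ 2 ≤ ((j : ℝ) + 3) ^ 2 + k.im ^ 2 := by
    intro c hc hc' j
    rw [← Complex.normSq_eq_norm_sq, Complex.normSq_apply]
    have hj : (0 : ℝ) ≤ j := j.cast_nonneg
    simp
    nlinarith
  refine (norm_hypergeometricPart_le (b := fun j => ((j : ℝ) + 3) ^ 2 + k.im ^ 2) (by linarith)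
    (fun j => ?_) n).trans (le_of_eq ?_)
  · have e1 := hb (1 / 3) (by norm_num) (by norm_num) j
    have e2 := hb (2 / 3) (by norm_num) (by norm_num) j
    push_cast at e1 e2
    nlinarith [sq_nonneg (‖1 / 3 + k + j‖ - ‖2 / 3 + k + j‖)]
  · rw [majorant, mul_assoc, ← Finset.prod_mul_distrib]
    congr 1
    refine Finset.prod_congr rfl fun j _ => ?_
    have hj : (j : ℝ) + 3 ≠ 0 := by positivity
    rw [show (j : ℝ) + 1 + 2 = j + 3 by ring]
    field_simp

lemma exists_bound_seriesSum : ∃ C : ℝ, ∀ k : ℂ, 1 ≤ k.re → k.re ≤ 2 →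
    |k.im| * ‖seriesSum k‖ ≤ C * Real.exp (Real.pi * |k.im|) := by
  -- From 9 + 10(4 + t²) ≤ 49(1 + t²) with t = Im k.
  refine ⟨49 * ∑' n : ℕ, ((n : ℝ) + 1) * majorant 2 n, fun k h1 h2 => ?_⟩
  have hs := (summable_majorant 2).hasSum.mul_left (49 * Real.exp (Real.pi * |k.im|))
  have hk : ‖k‖ ^ 2 ≤ 4 + k.im ^ 2 := by
    rw [← Complex.normSq_eq_norm_sq, Complex.normSq_apply]
    nlinarith
  have hb : ∀ n : ℕ, ‖((|k.im| : ℝ) : ℂ) * seriesTerm n k‖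
      ≤ 49 * Real.exp (Real.pi * |k.im|) * (((n : ℝ) + 1) * majorant 2 n) := by
    intro n
    rw [norm_mul, Complex.norm_real, Real.norm_eq_abs, abs_abs]
    have hm := majorant_nonneg 2 n
    have he := euler_sinh_shifted_partial_prod_le k.im n
    grw [norm_seriesTerm_le, norm_hypergeometricPart_le_of_mem_strip h1 h2, hk]
    set P := ∏ j ∈ Finset.range n, (1 + k.im ^ 2 / ((j : ℝ) + 3) ^ 2)
    have hP : 0 ≤ P := Finset.prod_nonneg fun _ _ => by positivity
    calc |k.im| * ((9 + 10 * (4 + k.im ^ 2)) * ((n + 1) * (majorant 2 n * P)))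
        ≤ |k.im| * ((49 * (1 + k.im ^ 2)) * ((n + 1) * (majorant 2 n * P))) := by
          gcongr; nlinarith [sq_nonneg k.im]
      _ = 49 * (|k.im| * (1 + k.im ^ 2) * P) * ((n + 1) * majorant 2 n) := by ring
      _ ≤ _ := by grw [he]
  have := tsum_of_norm_bounded hs hb
  rw [tsum_mul_left, norm_mul, Complex.norm_real, Real.norm_eq_abs, abs_abs] at this
  calc _ ≤ _ := this
    _ = _ := by ring

/-- The quotient is B(u,v)/Γ(v), and for Re u ≥ 1 the factor x^(u−1) of the beta integrand has
modulus at most one. The bound is thus the integral at u = 1. -/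
lemma exists_bound_Gamma_div_Gamma_add {v : ℂ} (hv : 0 < v.re) :
    ∃ C : ℝ, ∀ u : ℂ, 1 ≤ u.re → ‖Complex.Gamma u / Complex.Gamma (u + v)‖ ≤ C := by
  have hi := (Complex.betaIntegral_convergent (u := 1) (by simp) hv).norm
  refine ⟨(∫ x in (0 : ℝ)..1, ‖(x : ℂ) ^ ((1 : ℂ) - 1) * (1 - (x : ℂ)) ^ (v - 1)‖)
    / ‖Complex.Gamma v‖, fun u hu => ?_⟩
  have h0 : Complex.Gamma v ≠ 0 := Complex.Gamma_ne_zero_of_re_pos hv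
  have h1 : Complex.Gamma (u + v) ≠ 0 := Complex.Gamma_ne_zero_of_re_pos (by simp; linarith)
  have h2 := Complex.Gamma_mul_Gamma_eq_betaIntegral (s := u) (by linarith) hv
  have h3 : Complex.Gamma u / Complex.Gamma (u + v) = u.betaIntegral v / Complex.Gamma v := by
    field_simp
    linear_combination h2
  rw [h3, norm_div]
  gcongr
  refine intervalIntegral.norm_integral_le_of_norm_le zero_le_one
    (Filter.Eventually.of_forall fun x hx => ?_) hi
  rw [norm_mul, norm_mul, Complex.norm_cpow_eq_rpow_re_of_pos hx.1, sub_self, Complex.cpow_zero,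
    norm_one]
  gcongr
  exact Real.rpow_le_one hx.1.le hx.2 (by simpa using hu)

lemma exists_bound_normalization : ∃ C : ℝ, ∀ k : ℂ, 1 ≤ k.re → ‖normalization k‖ ≤ C := by
  obtain ⟨C, hC⟩ := exists_bound_Gamma_div_Gamma_add (v := 5 / 6) (by norm_num)
  obtain ⟨D, hD⟩ := exists_bound_Gamma_div_Gamma_add (v := 1 / 6) (by norm_num)
  -- Since 1/6 + 5/6 = 1, each Γ in the numerator pairs with one Γ(1 + k), the gaps being 5/6 and
  -- 1/6.
  refine ⟨1 * (C * D) / ‖Complex.Gamma (1 / 6) * Complex.Gamma (5 / 6)‖, fun k hk => ?_⟩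
  have h1 := hC (1 / 6 + k) (by norm_num; linarith)
  have h2 := hD (5 / 6 + k) (by norm_num; linarith)
  rw [show 1 / 6 + k + 5 / 6 = 1 + k by ring] at h1
  rw [show 5 / 6 + k + 1 / 6 = 1 + k by ring] at h2
  have h3 : ‖(1 / 4 : ℂ) ^ k‖ ≤ 1 := by
    rw [show (1 / 4 : ℂ) = ((1 / 4 : ℝ) : ℂ) by push_cast; rfl,
      Complex.norm_cpow_eq_rpow_re_of_pos (by norm_num)]
    exact Real.rpow_le_one (by norm_num) (by norm_num) (by linarith)
  have e : normalization k = (1 / 4 : ℂ) ^ k * ((Complex.Gamma (1 / 6 + k) / Complex.Gamma (1 + k))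
      * (Complex.Gamma (5 / 6 + k) / Complex.Gamma (1 + k)))
      / (Complex.Gamma (1 / 6) * Complex.Gamma (5 / 6)) := by
    rw [normalization, risingCpx, risingCpx, risingCpx, Complex.Gamma_one, div_one]
    simp only [div_eq_mul_inv, mul_inv]
    ring
  rw [e, norm_div, norm_mul, norm_mul]
  have hC0 := (norm_nonneg _).trans h1
  gcongr

/-! ### Periodic functions of restricted growth -/

lemma exists_int_of_sin_pi_mul_eq_zero {z : ℂ} (hz : Complex.sin (Real.pi * z) = 0) :
    ∃ m : ℤ, z = m := by
  obtain ⟨m, hm⟩ := Complex.sin_eq_zero_iff.mp hz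
  have hpi : (Real.pi : ℂ) ≠ 0 := by exact_mod_cast Real.pi_ne_zero
  exact ⟨m, mul_left_cancel₀ hpi (by rw [hm, mul_comm])⟩

lemma hasDerivAt_sin_pi_mul (z : ℂ) :
    HasDerivAt (fun w : ℂ => Complex.sin (Real.pi * w)) (Complex.cos (Real.pi * z) * Real.pi) z := by
  have := ((hasDerivAt_id z).const_mul (Real.pi : ℂ)).csin
  rwa [mul_one] at this

/-- The entire function `f(z) / sin (π z)`, for `f` vanishing at the integers. -/
noncomputable def divSin (f : ℂ → ℂ) (z : ℂ) : ℂ :=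
  if Complex.sin (Real.pi * z) = 0 then deriv f z / (Complex.cos (Real.pi * z) * Real.pi)
  else f z / Complex.sin (Real.pi * z)

/-- The singularities at the integers are removable: near m the quotient is that of the two
`dslope`s at m, and the zero of sin(πz) is simple. -/
lemma differentiable_divSin {f : ℂ → ℂ} (hf : Differentiable ℂ f) (h0 : ∀ m : ℤ, f m = 0) :
    Differentiable ℂ (divSin f) := by
  intro z
  have hs : Differentiable ℂ (fun w : ℂ => Complex.sin (Real.pi * w)) :=
    fun w => (hasDerivAt_sin_pi_mul w).differentiableAt
  by_cases hz : Complex.sin (Real.pi * z) = 0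
  · obtain ⟨m, rfl⟩ := exists_int_of_sin_pi_mul_eq_zero hz
    set s : ℂ → ℂ := fun w => Complex.sin (Real.pi * w)
    have hd : ∀ {g : ℂ → ℂ}, Differentiable ℂ g → DifferentiableAt ℂ (dslope g (m : ℂ)) m := by
      intro g hg
      exact ((Complex.differentiableOn_dslope univ_mem).mpr hg.differentiableOn).differentiableAt
        univ_mem
    have hc : Complex.cos (Real.pi * m) ≠ 0 := fun h => by
      have := Complex.sin_sq_add_cos_sq (Real.pi * m)
      rw [hz, h] at this
      norm_num at this
    have hpi : (Real.pi : ℂ) ≠ 0 := by exact_mod_cast Real.pi_ne_zero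
    have hds : dslope s m m = Complex.cos (Real.pi * m) * Real.pi := by
      rw [dslope_same]; exact (hasDerivAt_sin_pi_mul _).deriv
    have hne : dslope s m m ≠ 0 := by rw [hds]; exact mul_ne_zero hc hpi
    refine ((hd hf).div (hd hs) hne).congr_of_eventuallyEq ?_
    filter_upwards [Metric.ball_mem_nhds (m : ℂ) one_pos] with w hw
    rw [Pi.div_apply]
    by_cases hwm : w = m
    · rw [hwm, divSin, if_pos hz, hds, dslope_same]
    · have hsw : Complex.sin (Real.pi * w) ≠ 0 := fun h => by
        obtain ⟨l, rfl⟩ := exists_int_of_sin_pi_mul_eq_zero h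
        rw [Metric.mem_ball, dist_eq_norm, ← Int.cast_sub, Complex.norm_intCast] at hw
        have hlm : |l - m| < 1 := by exact_mod_cast hw
        exact hwm (by rw [sub_eq_zero.mp (Int.abs_lt_one_iff.mp hlm)])
      rw [divSin, if_neg hsw, dslope_of_ne _ hwm, dslope_of_ne _ hwm, slope_def_field,
        slope_def_field, h0, show s m = 0 from hz, sub_zero, sub_zero,
        div_div_div_cancel_right₀ (sub_ne_zero.mpr hwm)]
  · refine ((hf z).div (hs z) hz).congr_of_eventuallyEq ?_
    filter_upwards [hs.continuous.continuousAt.eventually_ne hz] with w hw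
    rw [divSin, if_neg hw, Pi.div_apply]

lemma divSin_add_one {f : ℂ → ℂ} (hp : ∀ z, f (z + 1) = f z) (z : ℂ) :
    divSin f (z + 1) = -divSin f z := by
  have h1 : Complex.sin (Real.pi * (z + 1)) = -Complex.sin (Real.pi * z) := by
    rw [mul_add, mul_one, Complex.sin_add_pi]
  have h2 : Complex.cos (Real.pi * (z + 1)) = -Complex.cos (Real.pi * z) := by
    rw [mul_add, mul_one, Complex.cos_add_pi]
  have h3 : deriv f (z + 1) = deriv f z := by
    rw [← deriv_comp_add_const]
    exact congrArg (fun g => deriv g z) (funext hp)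
  by_cases hz : Complex.sin (Real.pi * z) = 0
  · rw [divSin, divSin, if_pos hz, if_pos (by rw [h1, hz, neg_zero]), h2, h3, neg_mul, div_neg]
  · rw [divSin, divSin, if_neg hz, if_neg (by rwa [h1, neg_eq_zero]), h1, hp, div_neg]

lemma exists_re_mem_Icc_of_norm_periodic {g : ℂ → ℂ} (hg : ∀ z, ‖g (z + 1)‖ = ‖g z‖) (z : ℂ) :
    ∃ w : ℂ, 0 ≤ w.re ∧ w.re ≤ 1 ∧ w.im = z.im ∧ ‖g w‖ = ‖g z‖ := by
  have hn : ∀ n : ℤ, ∀ z, ‖g (z + n)‖ = ‖g z‖ := by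
    intro n
    induction n with
    | zero => simp
    | succ n ih =>
      intro z
      rw [← ih z, ← hg (z + ((n : ℤ) : ℂ))]
      push_cast
      rw [add_assoc]
    | pred n ih =>
      intro z
      rw [← ih z, ← hg (z + ((-(n : ℤ) - 1 : ℤ) : ℂ))]
      push_cast
      congr 2
      ring
  refine ⟨z + ((-⌊z.re⌋ : ℤ) : ℂ), ?_, ?_, ?_, hn _ z⟩
  · simpa using Int.floor_le z.re
  · have := Int.lt_floor_add_one z.re
    simp
    linarith
  · simp

/-- An entire function of period one that vanishes at the integers and grows at most like
`exp (π |Im z|)` is zero. -/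
theorem eq_zero_of_periodic_of_growth {f : ℂ → ℂ} (hf : Differentiable ℂ f)
    (hp : ∀ z, f (z + 1) = f z) (h0 : f 0 = 0) {C : ℝ}
    (hC : ∀ z : ℂ, 1 ≤ |z.im| → ‖f z‖ ≤ C * Real.exp (Real.pi * |z.im|)) (z : ℂ) : f z = 0 := by
  have hper : Function.Periodic f 1 := hp
  have hint : ∀ m : ℤ, f m = 0 := fun m => by
    have := hper.int_mul_eq m
    rwa [mul_one, h0] at this
  have hd := differentiable_divSin hf hint
  have hanti := divSin_add_one hp
  have hnorm : ∀ z, ‖divSin f (z + 1)‖ = ‖divSin f z‖ := fun z => by rw [hanti, norm_neg]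
  obtain ⟨D, hD⟩ := ((isCompact_Icc (a := (0 : ℝ)) (b := 1)).reProdIm
    (isCompact_Icc (a := (-1 : ℝ)) (b := 1))).exists_bound_of_continuousOn
      hd.continuous.continuousOn
  -- For |Im z| ≤ 1 an integer translation moves z into a compact rectangle; otherwise the growth of
  -- sin(πz) cancels that of f.
  have hb : ∀ z, ‖divSin f z‖ ≤ max D (4 * C) := by
    intro z
    rcases le_total |z.im| 1 with h | h
    · obtain ⟨w, h1, h2, h3, h4⟩ := exists_re_mem_Icc_of_norm_periodic hnorm z
      rw [← h4]
      refine (hD w ?_).trans (le_max_left _ _)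
      rw [Complex.mem_reProdIm]
      exact ⟨⟨h1, h2⟩, by rw [h3]; exact abs_le.mp h⟩
    · have him : ((Real.pi : ℂ) * z).im = Real.pi * z.im := by simp
      have hs := exp_abs_im_le_norm_sin (z := Real.pi * z) (by
        rw [him, abs_mul, abs_of_pos Real.pi_pos]
        nlinarith [Real.pi_gt_three])
      rw [him, abs_mul, abs_of_pos Real.pi_pos] at hs
      have hs0 : 0 < ‖Complex.sin (Real.pi * z)‖ := by
        linarith [Real.exp_pos (Real.pi * |z.im|)]
      refine le_trans ?_ (le_max_right _ _)
      have h1 := hC z h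
      have hC0 : 0 ≤ C := nonneg_of_mul_nonneg_left ((norm_nonneg _).trans h1) (Real.exp_pos _)
      rw [divSin, if_neg (norm_pos_iff.mp hs0), norm_div, div_le_iff₀ hs0]
      grw [h1, hs]
      exact le_of_eq (by ring)
  have hconst := hd.apply_eq_apply_of_bounded
    ((isBounded_iff_forall_norm_le.mpr ⟨_, by rintro _ ⟨z, rfl⟩; exact hb z⟩))
  -- Liouville gives a constant, and antiperiodicity forces it to be zero. This is why growth of the
  -- exact order exp(π|Im z|) is still admissible.
  have hzero : divSin f z = 0 := by
    have h1 := hanti z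
    rw [hconst (z + 1) z] at h1
    linear_combination h1 / 2
  by_cases hz : Complex.sin (Real.pi * z) = 0
  · obtain ⟨m, rfl⟩ := exists_int_of_sin_pi_mul_eq_zero hz
    exact hint m
  · rw [divSin, if_neg hz, div_eq_zero_iff] at hzero
    exact hzero.resolve_right hz

lemma apply_eq_apply_of_sub_eq_int {H : ℂ → ℂ} (hp : ∀ z : ℂ, 0 < z.re → H (z + 1) = H z)
    {z w : ℂ} (hz : 0 < z.re) (hw : 0 < w.re) {m : ℤ} (h : w = z + m) : H w = H z := by
  have hn : ∀ n : ℕ, ∀ z : ℂ, 0 < z.re → H (z + n) = H z := by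
    intro n
    induction n with
    | zero => simp
    | succ n ih =>
      intro z hz
      have : 0 < (z + n).re := by simp; positivity
      rw [Nat.cast_add_one, ← add_assoc, hp _ this, ih z hz]
  obtain ⟨n, rfl | rfl⟩ := m.eq_nat_or_neg
  · rw [h, Int.cast_natCast, hn n z hz]
  · rw [show z = w + n by rw [h]; push_cast; ring, hn n w hw]

/-- A holomorphic function of period one on the right half-plane that grows at most like
`exp (π |Im z|)` is constant. -/
theorem apply_eq_apply_of_periodic_of_growth {H : ℂ → ℂ}
    (hH : DifferentiableOn ℂ H {z | 0 < z.re}) (hp : ∀ z : ℂ, 0 < z.re → H (z + 1) = H z) {C : ℝ}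
    (hC : ∀ z : ℂ, 1 ≤ z.re → z.re ≤ 2 → 1 ≤ |z.im| →
      ‖H z‖ ≤ C * Real.exp (Real.pi * |z.im|)) {x₀ : ℝ} {z : ℂ} (hx₀ : 0 < x₀) (hz : 0 < z.re) :
    H z = H x₀ := by
  -- The entire periodic extension of H, obtained by translating into 1 ≤ Re z < 2. By periodicity
  -- any other translate in the right half-plane gives the same value, so near each point the
  -- translation may be held fixed.
  let E : ℂ → ℂ := fun z => H (z + ((1 - ⌊z.re⌋ : ℤ) : ℂ))
  have hre : ∀ z : ℂ, 1 ≤ (z + ((1 - ⌊z.re⌋ : ℤ) : ℂ)).re ∧ (z + ((1 - ⌊z.re⌋ : ℤ) : ℂ)).re ≤ 2 := by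
    intro z
    have h1 := Int.floor_le z.re
    have h2 := Int.lt_floor_add_one z.re
    constructor <;> simp <;> linarith
  have hE : ∀ z : ℂ, ∀ m : ℤ, 0 < (z + m).re → E z = H (z + m) := by
    intro z m hm
    refine apply_eq_apply_of_sub_eq_int hp hm (m := 1 - ⌊z.re⌋ - m) (by linarith [(hre z).1]) ?_
    push_cast; ring
  have hEp : ∀ z, E (z + 1) = E z := by
    intro z
    rw [hE (z + 1) (-⌊z.re⌋) (by
      have := (hre z).1; simp at this ⊢; linarith)]
    simp only [E]
    congr 1
    push_cast; ring
  have hEd : Differentiable ℂ E := by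
    intro w
    have ho : IsOpen {v : ℂ | 0 < (v + ((1 - ⌊w.re⌋ : ℤ) : ℂ)).re} :=
      isOpen_lt continuous_const (by fun_prop)
    have hw : 0 < (w + ((1 - ⌊w.re⌋ : ℤ) : ℂ)).re := by linarith [(hre w).1]
    have h1 : DifferentiableAt ℂ H (w + ((1 - ⌊w.re⌋ : ℤ) : ℂ)) :=
      (hH _ hw).differentiableAt ((isOpen_lt continuous_const Complex.continuous_re).mem_nhds hw)
    refine (h1.comp w (differentiableAt_id.add_const _)).congr_of_eventuallyEq ?_
    filter_upwards [ho.mem_nhds hw] with v hv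
    exact hE v _ hv
  have hEC : ∀ z : ℂ, 1 ≤ |z.im| → ‖E z‖ ≤ C * Real.exp (Real.pi * |z.im|) := by
    intro z hz
    have := hC _ (hre z).1 (hre z).2 (by simpa using hz)
    have him : (z + ((1 - ⌊z.re⌋ : ℤ) : ℂ)).im = z.im := by simp
    rwa [him] at this
  have key : ∀ w, E (w + x₀) - E x₀ = 0 := by
    refine eq_zero_of_periodic_of_growth (C := C + ‖E x₀‖)
      (((hEd.comp (differentiable_id.add_const (x₀ : ℂ)))).sub_const _)
      (fun w => by rw [add_right_comm, hEp]) (by simp) (fun w hw => ?_)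
    have him : (w + x₀).im = w.im := by simp
    have h1 := hEC (w + x₀) (by rwa [him])
    rw [him] at h1
    have h2 : 1 ≤ Real.exp (Real.pi * |w.im|) := Real.one_le_exp (by positivity)
    calc ‖E (w + x₀) - E x₀‖ ≤ C * Real.exp (Real.pi * |w.im|) + ‖E x₀‖ * 1 := by
          grw [norm_sub_le, h1, mul_one]
      _ ≤ C * Real.exp (Real.pi * |w.im|) + ‖E x₀‖ * Real.exp (Real.pi * |w.im|) := by gcongr
      _ = _ := by ring
  have h1 := hE z 0 (by simpa using hz)
  have h2 := hE x₀ 0 (by simpa using hx₀)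
  have h3 := key (z - x₀)
  rw [sub_add_cancel, sub_eq_zero] at h3
  simp only [Int.cast_zero, add_zero] at h1 h2
  rw [← h1, ← h2, h3]

/-! ### Evaluation of the series -/

/-- The closed form of the sum of the series. -/
noncomputable def closedForm (k : ℂ) : ℂ :=
  4 * (Real.sqrt 3 : ℂ) / (3 * (Real.pi : ℂ)) * (4 : ℂ) ^ k *
    (risingCpx 1 k ^ 2 / (risingCpx (1 / 6) k * risingCpx (5 / 6) k))

lemma mem_pairDomain_of_re_pos {k : ℂ} (hk : 0 < k.re) : k ∈ pairDomain := by
  refine ⟨mem_termDomain_of_re_pos hk, fun m => ⟨fun h => ?_, fun h => ?_⟩⟩ <;>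
  · have := congrArg Complex.re h
    norm_num at this
    have h0 : (0 : ℝ) ≤ m := m.cast_nonneg
    linarith

lemma Gamma_add_ne_zero {c k : ℂ} (hc : 0 < c.re) (hk : 0 < k.re) : Complex.Gamma (c + k) ≠ 0 :=
  Complex.Gamma_ne_zero_of_re_pos (by rw [Complex.add_re]; positivity)

lemma differentiableOn_normalization : DifferentiableOn ℂ normalization {k | 0 < k.re} := by
  have hG : ∀ c : ℂ, 0 < c.re →
      DifferentiableOn ℂ (fun k => Complex.Gamma (c + k)) {k | 0 < k.re} := by
    intro c hc k hk
    have hk' : 0 < k.re := hk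
    refine DifferentiableAt.differentiableWithinAt ?_
    refine DifferentiableAt.comp k (Complex.differentiableAt_Gamma _ fun m h => ?_)
      (differentiableAt_id.const_add c)
    have := congrArg Complex.re h
    simp at this
    have h0 : (0 : ℝ) ≤ m := m.cast_nonneg
    linarith
  refine DifferentiableOn.mul (fun k _ => ?_) (DifferentiableOn.div
    (((hG _ (by norm_num)).div_const _).mul ((hG _ (by norm_num)).div_const _))
    (((hG _ (by norm_num)).div_const _).pow 2)
    fun k hk => pow_ne_zero 2 (risingCpx_one_ne_zero (mem_termDomain_of_re_pos hk)))
  exact (differentiableAt_id.const_cpow (Or.inl (by norm_num))).differentiableWithinAt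

/-- At k = 1/2 the factor (1/2 − k)_n is (0)_n, which vanishes for n ≥ 1. -/
lemma seriesSum_one_half : seriesSum (1 / 2) = 6 := by
  rw [seriesSum, tsum_eq_single 0]
  · norm_num [seriesTerm, risingNat_zero]
  · intro n hn
    obtain ⟨m, rfl⟩ := Nat.exists_eq_succ_of_ne_zero hn
    rw [seriesTerm, Nat.succ_eq_add_one, risingNat_succ_left (1 / 2 - 1 / 2)]
    simp

/-- The shift by 1/2 turns 1/6 and 5/6 into 2/3 and 4/3, so the reflection formula at 1/3, 1/6 and
1/2 evaluates every Γ product. -/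
lemma normalization_one_half :
    normalization (1 / 2) = 2 * (Real.sqrt 3 : ℂ) / (9 * Real.pi) := by
  have hpi : (Real.pi : ℂ) ≠ 0 := by exact_mod_cast Real.pi_ne_zero
  have h3 : (Real.sqrt 3 : ℂ) ≠ 0 := by
    exact_mod_cast (Real.sqrt_pos.mpr (by norm_num : (0 : ℝ) < 3)).ne'
  have h33 : (Real.sqrt 3 : ℂ) ^ 2 = 3 := by
    rw [← Complex.ofReal_pow, Real.sq_sqrt (by norm_num)]; norm_num
  have g1 : Complex.Gamma (1 / 3) * Complex.Gamma (2 / 3) = 2 * Real.pi / Real.sqrt 3 := by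
    have := Complex.Gamma_mul_Gamma_one_sub (1 / 3)
    rw [show (1 - 1 / 3 : ℂ) = 2 / 3 by norm_num,
      show (Real.pi * (1 / 3) : ℂ) = ((Real.pi / 3 : ℝ) : ℂ) by push_cast; ring,
      ← Complex.ofReal_sin, Real.sin_pi_div_three] at this
    rw [this]; push_cast; field_simp
  have g2 : Complex.Gamma (1 / 6) * Complex.Gamma (5 / 6) = 2 * Real.pi := by
    have := Complex.Gamma_mul_Gamma_one_sub (1 / 6)
    rw [show (1 - 1 / 6 : ℂ) = 5 / 6 by norm_num,
      show (Real.pi * (1 / 6) : ℂ) = ((Real.pi / 6 : ℝ) : ℂ) by push_cast; ring,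
      ← Complex.ofReal_sin, Real.sin_pi_div_six] at this
    rw [this]; push_cast; field_simp
  have g3 : Complex.Gamma (1 + 1 / 2) ^ 2 = Real.pi / 4 := by
    have h := Complex.Gamma_mul_Gamma_one_sub (1 / 2)
    rw [show (1 - 1 / 2 : ℂ) = 1 / 2 by norm_num,
      show (Real.pi * (1 / 2) : ℂ) = ((Real.pi / 2 : ℝ) : ℂ) by push_cast; ring,
      ← Complex.ofReal_sin, Real.sin_pi_div_two] at h
    rw [add_comm, Complex.Gamma_add_one _ (by norm_num), mul_pow, sq (Complex.Gamma _), h]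
    push_cast; ring
  have g4 : Complex.Gamma (5 / 6 + 1 / 2) = 1 / 3 * Complex.Gamma (1 / 3) := by
    rw [← Complex.Gamma_add_one _ (by norm_num)]; norm_num
  have g5 : (1 / 4 : ℂ) ^ (1 / 2 : ℂ) = 1 / 2 := by
    have h := Complex.pow_cpow_nat_inv (x := 1 / 2) (n := 2) two_ne_zero
      (by norm_num [Complex.arg]; positivity) (by norm_num [Complex.arg]; positivity)
    convert h using 2 <;> norm_num
  rw [normalization, risingCpx, risingCpx, risingCpx, g4, g5, Complex.Gamma_one, div_one, g3,
    show (1 / 6 + 1 / 2 : ℂ) = 2 / 3 by norm_num, div_mul_div_comm (Complex.Gamma (2 / 3)), g2,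
    show Complex.Gamma (2 / 3) * (1 / 3 * Complex.Gamma (1 / 3))
      = 1 / 3 * (Complex.Gamma (1 / 3) * Complex.Gamma (2 / 3)) by ring, g1]
  field_simp
  rw [h33]
  norm_num

lemma seriesSum_mul_normalization {k : ℂ} (hk : 0 < k.re) :
    seriesSum k * normalization k = 4 * (Real.sqrt 3 : ℂ) / (3 * (Real.pi : ℂ)) := by
  obtain ⟨C, hC⟩ := exists_bound_seriesSum
  obtain ⟨D, hD⟩ := exists_bound_normalization
  have h := apply_eq_apply_of_periodic_of_growth (H := fun k => seriesSum k * normalization k)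
    (C := C * D) (differentiableOn_seriesSum.mul differentiableOn_normalization)
    (fun z hz => ?_) (fun z h1 h2 h3 => ?_) (x₀ := 1 / 2) (by norm_num) hk
  · rw [h, show ((1 / 2 : ℝ) : ℂ) = 1 / 2 by push_cast; rfl, seriesSum_one_half,
      normalization_one_half]
    ring
  · have hz' := mem_pairDomain_of_re_pos hz
    have h1 : 1 / 6 + z ≠ 0 := by simpa using (hz'.2 0).1
    have h2 : 5 / 6 + z ≠ 0 := by simpa using (hz'.2 0).2
    have h3 : 1 + z ≠ 0 := by simpa using one_add_add_ne_zero hz'.1 0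
    have e1 := seriesSum_add_one hz'.1
    have e2 := normalization_add_one hz'
    have h4 : (1 / 6 + z) * (5 / 6 + z) * (4 * (1 + z) ^ 2) ≠ 0 :=
      mul_ne_zero (mul_ne_zero h1 h2) (mul_ne_zero (by norm_num) (pow_ne_zero 2 h3))
    apply mul_left_cancel₀ h4
    linear_combination (4 * (1 + z) ^ 2 * normalization (z + 1)) * e1
      + 4 * (1 + z) ^ 2 * seriesSum z * e2
  · have hS : ‖seriesSum z‖ ≤ C * Real.exp (Real.pi * |z.im|) := by
      refine le_trans ?_ (hC z h1 h2)
      exact le_mul_of_one_le_left (norm_nonneg _) h3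
    have hN := hD z h1
    have h0 := (norm_nonneg _).trans hS
    calc ‖seriesSum z * normalization z‖ ≤ C * Real.exp (Real.pi * |z.im|) * D := by
          rw [norm_mul]; gcongr
      _ = _ := by ring

lemma closedForm_mul_normalization {k : ℂ} (hk : 0 < k.re) :
    closedForm k * normalization k = 4 * (Real.sqrt 3 : ℂ) / (3 * (Real.pi : ℂ)) := by
  have h1 := risingCpx_one_ne_zero (mem_termDomain_of_re_pos hk)
  have h2 : risingCpx (1 / 6) k ≠ 0 :=
    div_ne_zero (Gamma_add_ne_zero (by norm_num) hk) Gamma_one_sixth_ne_zero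
  have h3 : risingCpx (5 / 6) k ≠ 0 :=
    div_ne_zero (Gamma_add_ne_zero (by norm_num) hk) Gamma_five_sixths_ne_zero
  have h4 : (4 : ℂ) ^ k * (1 / 4 : ℂ) ^ k = 1 := by
    rw [one_div, Complex.inv_cpow _ _ (by
      rw [show (4 : ℂ) = ((4 : ℝ) : ℂ) by norm_num, Complex.arg_ofReal_of_nonneg (by norm_num)]
      exact Real.pi_ne_zero.symm)]
    exact mul_inv_cancel₀ (by simp [Complex.cpow_eq_zero_iff])
  rw [closedForm, normalization]
  generalize risingCpx 1 k = a at *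
  generalize risingCpx (1 / 6) k = b at *
  generalize risingCpx (5 / 6) k = c at *
  calc _ = 4 * (Real.sqrt 3 : ℂ) / (3 * (Real.pi : ℂ)) * ((4 : ℂ) ^ k * (1 / 4 : ℂ) ^ k) *
        ((a ^ 2 / (b * c)) * (b * c / a ^ 2)) := by ring
    _ = _ := by
      rw [h4, div_mul_div_cancel₀ (mul_ne_zero h2 h3), div_self (pow_ne_zero 2 h1), mul_one,
        mul_one]

/-- The recurrence for 1/Γ holds everywhere, so the poles of (1/6)_k (5/6)_k need no exception. -/
lemma closedForm_add_one {k : ℂ} (hk : k ∈ termDomain) :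
    (1 / 6 + k) * (5 / 6 + k) * closedForm (k + 1) = 4 * (1 + k) ^ 2 * closedForm k := by
  have h1 : 1 + k ≠ 0 := by simpa using one_add_add_ne_zero hk 0
  have h2 := Complex.one_div_Gamma_eq_self_mul_one_div_Gamma_add_one (1 / 6 + k)
  have h3 := Complex.one_div_Gamma_eq_self_mul_one_div_Gamma_add_one (5 / 6 + k)
  rw [closedForm, closedForm, risingCpx_add_one h1, Complex.cpow_add _ _ (by norm_num),
    Complex.cpow_one]
  simp only [risingCpx, ← add_assoc, div_eq_mul_inv, mul_inv, inv_inv, one_mul] at h2 h3 ⊢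
  rw [h2, h3]
  ring

lemma seriesSum_eq_closedForm {k : ℂ} (hk : k ∈ termDomain) : seriesSum k = closedForm k := by
  -- Induction on the number of unit steps needed to reach Re k > 0. Passing from k + 1 back to k
  -- divides only by 4(1+k)², which is nonzero on `termDomain`; a zero of (1/6+k)(5/6+k) does no
  -- harm.
  have key : ∀ m : ℕ, ∀ k ∈ termDomain, 0 < k.re + m → seriesSum k = closedForm k := by
    intro m
    induction m with
    | zero =>
      intro k _ hm
      have hm : 0 < k.re := by simpa using hm
      have hc := closedForm_mul_normalization hm
      have hN : normalization k ≠ 0 := fun h => by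
        rw [h, mul_zero] at hc
        have : (4 * (Real.sqrt 3 : ℂ) / (3 * (Real.pi : ℂ))) ≠ 0 := by simp
        exact this hc.symm
      exact mul_right_cancel₀ hN ((seriesSum_mul_normalization hm).trans hc.symm)
    | succ m ih =>
      intro k hk hm
      have h1 : 1 + k ≠ 0 := by simpa using one_add_add_ne_zero hk 0
      have h2 : (4 * (1 + k) ^ 2 : ℂ) ≠ 0 := by simpa using h1
      apply mul_left_cancel₀ h2
      rw [← seriesSum_add_one hk, ← closedForm_add_one hk,
        ih (k + 1) (add_one_mem_termDomain hk) (by push_cast at hm; simp; linarith)]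
  obtain ⟨m, hm⟩ := exists_nat_gt (-k.re)
  exact key m k hk (by linarith)

lemma hasSum_seriesTerm {k : ℂ} (hk : k ∈ termDomain) :
    HasSum (fun n => seriesTerm n k) (closedForm k) :=
  seriesSum_eq_closedForm hk ▸ (summable_seriesTerm k).hasSum

/-! ### The real series at k = 0 -/

lemma risingNat_ofReal (x : ℝ) (n : ℕ) :
    risingNat (x : ℂ) n = ((ascPochhammer ℝ n).eval x : ℝ) := by
  induction n with
  | zero => simp [risingNat_zero]
  | succ n ih => rw [risingNat_succ, ih, ascPochhammer_succ_eval]; push_cast; rfl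

lemma seriesTerm_zero_right (n : ℕ) :
    seriesTerm n 0 = (((-9 / 16 : ℝ) ^ n *
        ((ascPochhammer ℝ n).eval (1 / 2) * (ascPochhammer ℝ n).eval (1 / 3) *
          (ascPochhammer ℝ n).eval (2 / 3) / (ascPochhammer ℝ n).eval 1 ^ 3) * (5 * n + 1) : ℝ)
          : ℂ) := by
  have h1 := risingNat_ofReal (1 / 2) n
  have h2 := risingNat_ofReal (1 / 3) n
  have h3 := risingNat_ofReal (2 / 3) n
  have h4 := risingNat_ofReal 1 n
  push_cast at h1 h2 h3 h4 ⊢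
  have h5 := risingNat_ne_zero one_half_add_ne_zero n
  have h6 := risingNat_ne_zero one_add_cast_ne_zero n
  have h7 : (2 * n + 1 : ℂ) ≠ 0 := by exact_mod_cast (2 * n).succ_ne_zero
  rw [seriesTerm, mul_zero, sub_zero, add_zero, add_zero, add_zero, add_zero, zero_mul, add_zero,
    mul_div_cancel_right₀ _ h7, ← h1, ← h2, ← h3, ← h4]
  field_simp

lemma closedForm_zero : closedForm 0 = ((4 / (Real.sqrt 3 * Real.pi) : ℝ) : ℂ) := by
  have h3 : (Real.sqrt 3 : ℂ) ≠ 0 := by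
    exact_mod_cast (Real.sqrt_pos.mpr (by norm_num : (0 : ℝ) < 3)).ne'
  have h33 : (Real.sqrt 3 : ℂ) ^ 2 = 3 := by
    rw [← Complex.ofReal_pow, Real.sq_sqrt (by norm_num)]; norm_num
  have hpi : (Real.pi : ℂ) ≠ 0 := by exact_mod_cast Real.pi_ne_zero
  rw [closedForm, risingCpx, risingCpx, risingCpx, add_zero, add_zero, add_zero,
    div_self Gamma_one_sixth_ne_zero, div_self Gamma_five_sixths_ne_zero, Complex.Gamma_one,
    Complex.cpow_zero]
  push_cast
  field_simp
  rw [h33]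

/-- At the poles of `(1/6)_k (5/6)_k`, which Mathlib's `Γ` sends to `0`, the right-hand side of the
first identity takes the value `0`, which is its limit there (the value of `1 / Γ` at a pole of
`Γ`). -/
theorem mainTheorem5 :
    (∀ k ∈ termDomain,
      HasSum (fun n : ℕ => seriesTerm n k)
        (4 * (Real.sqrt 3 : ℂ) / (3 * (Real.pi : ℂ)) * (4 : ℂ) ^ k *
          (risingCpx 1 k ^ 2 / (risingCpx (1 / 6) k * risingCpx (5 / 6) k)))) ∧
    IsWZDemonstrableOn pairDomain normalizedTerm ∧
    HasSum (fun n : ℕ => (-9 / 16 : ℝ) ^ n *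
        ((ascPochhammer ℝ n).eval (1 / 2) * (ascPochhammer ℝ n).eval (1 / 3) *
          (ascPochhammer ℝ n).eval (2 / 3) / (ascPochhammer ℝ n).eval 1 ^ 3) * (5 * n + 1))
      (4 / (Real.sqrt 3 * Real.pi)) := by
  refine ⟨fun k hk => hasSum_seriesTerm hk, ⟨companion, ⟨isHypergeometricOn_companion,
    isHypergeometricOn_normalizedTerm, fun n k hk => companion_sub hk n⟩, fun k _ => ⟨?_, ?_⟩⟩, ?_⟩
  · rw [companion, companionTerm_zero, zero_mul]
  · simpa [companion] using (tendsto_companionTerm k).mul_const (normalization k)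
  · have h := hasSum_seriesTerm (k := 0) fun m h => Nat.cast_add_one_ne_zero (R := ℂ) m
      (by linear_combination h)
    simp_rw [seriesTerm_zero_right] at h
    rw [closedForm_zero] at h
    exact Complex.hasSum_ofReal.mp h
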